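/- Let $M$ be a (finite-dimensional, Hausdorff, boundaryless) smooth manifold. On sections of $A=TM\oplus T^*M$ consider the standard Courant bracket $(X+\xi)\circ(Y+\eta)=[X,Y]+(\mathcal L_X\eta-i_Y d\xi)$ and the pairing $\langle X+\xi,Y+\eta\rangle=\langle\xi,Y\rangle+\langle\eta,X\rangle$. For a $(1,1)$-tensor $N$ on $A$ (a smooth bundle morphism $N:A\to A$) put $s\circ_N t=N(s)\circ t+s\circ N(t)-N(s\circ t)$ and $T_N(s,t)=N(s)\circ N(t)-N(s\circ_N t)$. Call $N$ a Lie bialgebroid-Nijenhuis tensor (for the trivial Lie bialgebroid $(TM,T^*M)$) if $N$ is paired, i.e. $N+N^*=\lambda I$ for some $\lambda\in\mathbb R$, where $N^*$ is the adjoint with respect to the pairing, and if for both $L=TM$ and $L=T^*M$ the smooth sections of $L$ are closed under $\circ_N$ and $T_N(s,t)=0$ for all smooth sections $s,t$ of $L$. A field $N$ of fibrewise linear endomorphisms of $A$ is a Lie bialgebroid-Nijenhuis tensor if and only if there are $\lambda\in\mathbb R$ and $N_0:TM\to TM$, $\Lambda:T^*M\to TM$, $\Omega:TM\to T^*M$ such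 that $$N=\begin{pmatrix}\frac{\lambda}{2}I+N_0&\Lambda\\ \Omega&\frac{\lambda}{2}I-{}^tN_0\end{pmatrix},$$ where $N_0$ is a Nijenhuis tensor, $(N_0,\Omega)$ is a presymplectic-Nijenhuis structure, and $(N_0,\Lambda)$ is a Poisson-Nijenhuis structure. Here: - $N_0$ is a Nijenhuis tensor if it is a smooth $(1,1)$-tensor on $M$ with $[N_0X,N_0Y]=N_0\big([N_0X,Y]+[X,N_0Y]-N_0[X,Y]\big)$ for all smooth vector fields $X,Y$; - $(N_0,\Omega)$ is a presymplectic-Nijenhuis structure if $N_0$ is a Nijenhuis tensor, $\Omega$ is a smooth closed 2-form (of arbitrary rank, with $\Omega(X,Y)=\langle\Omega X,Y\rangle$), and $\Omega N_0$ is skew-symmetric with $d(\Omega N_0)=0$; - $(N_0,\Lambda)$ is a Poisson-Nijenhuis structure if $N_0$ is a Nijenhuis tensor, $\Lambda$ is a Poisson tensor (a smooth bivector field for which $\{f,g\}=\langle dg,\Lambda\,df\rangle$ satisfies the Jacobi identity), $N_0\Lambda=\Lambda\,{}^tN_0$, and $[{}^tN_0\xi,\eta]^{\Lambda}+[\xi,{}^tN_0\eta]^{\Lambda}-{}^tN_0[\xi,\eta]^{\Lambda}=[\xi,\eta]^{N_0\Lambda}$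 for all smooth 1-forms $\xi,\eta$, where $[\xi,\eta]^{P}=\mathcal L_{P\xi}\eta-i_{P\eta}d\xi$. -/

import Mathlib

open Bundle VectorField
open scoped Manifold ContDiff

noncomputable section

namespace CourantNijenhuis

section

variable {E : Type*} [NormedAddCommGroup E] [NormedSpace ℝ E]
  {H : Type*} [TopologicalSpace H] (I : ModelWithCorners ℝ E H)
  {M : Type*} [TopologicalSpace M] [ChartedSpace H M]

/-! ### The bundles `TM`, `T*M`, `TM ⊕ T*M` and their sections -/

/-- The cotangent space of `M` at `x`. -/
abbrev Cotangent (x : M) : Type _ := TangentSpace I x →L[ℝ] ℝ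

/-- The fibre of `A = TM ⊕ T*M` at `x`. -/
abbrev Fibre (x : M) : Type _ := TangentSpace I x × Cotangent I x

/-- Vector fields, not necessarily smooth. -/
abbrev VField (M : Type*) [TopologicalSpace M] [ChartedSpace H M] : Type _ :=
  Π x : M, TangentSpace I x

/-- One-forms, not necessarily smooth. -/
abbrev OneForm (M : Type*) [TopologicalSpace M] [ChartedSpace H M] : Type _ :=
  Π x : M, Cotangent I x

/-- Sections `X + ξ` of `A = TM ⊕ T*M`, not necessarily smooth. -/
abbrev ASection (M : Type*) [TopologicalSpace M] [ChartedSpace H M] : Type _ :=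
  Π x : M, Fibre I x

/-- Fields of endomorphisms `TM → TM`, not necessarily smooth. -/
abbrev EndField (M : Type*) [TopologicalSpace M] [ChartedSpace H M] : Type _ :=
  Π x : M, TangentSpace I x →L[ℝ] TangentSpace I x

/-- Fields of linear maps `TM → T*M` (covariant 2-tensors), not necessarily smooth.
The map `Ω` corresponds to the bilinear form `Ω(X, Y) = ⟨ΩX, Y⟩`. -/
abbrev CovTensor (M : Type*) [TopologicalSpace M] [ChartedSpace H M] : Type _ :=
  Π x : M, TangentSpace I x →L[ℝ] Cotangent I x

/-- Fields of linear maps `T*M → TM` (contravariant 2-tensors), not necessarily smooth. -/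
abbrev ContraTensor (M : Type*) [TopologicalSpace M] [ChartedSpace H M] : Type _ :=
  Π x : M, Cotangent I x →L[ℝ] TangentSpace I x

/-- Fields of endomorphisms `A → A` of `A = TM ⊕ T*M`, not necessarily smooth. -/
abbrev AEndField (M : Type*) [TopologicalSpace M] [ChartedSpace H M] : Type _ :=
  Π x : M, Fibre I x →L[ℝ] Fibre I x

variable {I} [IsManifold I ∞ M]

/-- Smooth vector fields. -/
def SmoothVF (X : VField I M) : Prop :=
  ContMDiff I (I.prod 𝓘(ℝ, E)) ∞
    (fun x ↦ TotalSpace.mk' E (E := fun x : M ↦ TangentSpace I x) x (X x))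

/-- Smooth one-forms: smooth sections of the bundle `Hom(TM, ℝ)`. -/
def SmoothForm (ξ : OneForm I M) : Prop :=
  ContMDiff I (I.prod 𝓘(ℝ, E →L[ℝ] ℝ)) ∞
    (fun x ↦ TotalSpace.mk' (E →L[ℝ] ℝ)
      (E := fun x : M ↦ TangentSpace I x →L[ℝ] Bundle.Trivial M ℝ x) x (ξ x))

/-- Smooth sections of `TM ⊕ T*M`. -/
def SmoothSection (s : ASection I M) : Prop :=
  SmoothVF (fun x ↦ (s x).1) ∧ SmoothForm (fun x ↦ (s x).2)

/-! A field of fibrewise linear maps between vector bundles is a smooth bundle morphism iff it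
maps smooth sections to smooth sections (i.e. iff it induces a `C^∞(M)`-linear map between the
modules of smooth sections); smoothness of tensors is expressed in this form. -/

/-- `(1,1)`-tensors on `TM`: smooth bundle morphisms `TM → TM`. -/
def SmoothEnd (N₀ : EndField I M) : Prop :=
  ∀ X : VField I M, SmoothVF X → SmoothVF (fun x ↦ N₀ x (X x))

/-- Smooth bundle morphisms `TM → T*M`. -/
def SmoothCov (Ω : CovTensor I M) : Prop :=
  ∀ X : VField I M, SmoothVF X → SmoothForm (fun x ↦ Ω x (X x))

/-- Smooth bundle morphisms `T*M → TM`. -/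
def SmoothContra (Λ : ContraTensor I M) : Prop :=
  ∀ ξ : OneForm I M, SmoothForm ξ → SmoothVF (fun x ↦ Λ x (ξ x))

/-- `(1,1)`-tensors on `A = TM ⊕ T*M`: smooth bundle morphisms `A → A`. -/
def SmoothAEnd (N : AEndField I M) : Prop :=
  ∀ s : ASection I M, SmoothSection s → SmoothSection (fun x ↦ N x (s x))

/-! ### Lie derivative and exterior derivative of one-forms -/

/-- Differentiability of a one-form at a point. -/
def DiffFormAt (ξ : OneForm I M) (x : M) : Prop :=
  MDifferentiableAt I (I.prod 𝓘(ℝ, E →L[ℝ] ℝ))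
    (fun x ↦ TotalSpace.mk' (E →L[ℝ] ℝ)
      (E := fun x : M ↦ TangentSpace I x →L[ℝ] Bundle.Trivial M ℝ x) x (ξ x)) x

lemma SmoothForm.diffFormAt {ξ : OneForm I M} (h : SmoothForm ξ) (x : M) : DiffFormAt ξ x :=
  (h x).mdifferentiableAt (by simp)

lemma DiffFormAt.apply {ξ : OneForm I M} {Y : VField I M} {x : M} (h : DiffFormAt ξ x)
    (hY : MDiffAt (T% Y) x) : MDiffAt (fun y ↦ ξ y (Y y)) x := by
  have := MDifferentiableAt.clm_bundle_apply (E₁ := fun x : M ↦ TangentSpace I x)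
    (E₂ := Bundle.Trivial M ℝ) (b := fun x : M ↦ x) h hY
  rw [mdifferentiableAt_totalSpace] at this
  exact this.2

variable [FiniteDimensional ℝ E]

/-- The right-hand side of `(L_X η)(Y) = X(η(Y)) - η([X, Y])` is tensorial in `Y`. -/
lemma tensorialAt_lie (X : VField I M) {η : OneForm I M} {x : M} (h : DiffFormAt η x) :
    TensorialAt I E (fun Y : VField I M ↦
      mvfderiv I (fun y ↦ η y (Y y)) x (X x) - η x (mlieBracket I X Y x)) x where
  smul {f Y} hf hY := by
    have h1 : (fun y ↦ η y ((f • Y) y)) = f • (fun y ↦ η y (Y y)) := by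
      ext y; simp
    rw [h1, mlieBracket_smul_right hf hY, mvfderiv_smul hf (h.apply hY)]
    simp
    ring
  add {Y Z} hY hZ := by
    have h1 : (fun y ↦ η y ((Y + Z) y)) = (fun y ↦ η y (Y y)) + (fun y ↦ η y (Z y)) := by
      ext y; simp
    rw [h1, mlieBracket_add_right hY hZ, mvfderiv_add (h.apply hY) (h.apply hZ)]
    simp
    ring

open Classical in
/-- The Lie derivative `L_X η` of a one-form along a vector field, i.e. the one-form with
`(L_X η)(Y) = X(η(Y)) - η([X, Y])` (with the value `0` where `η` is not differentiable). -/
def lieDeriv (X : VField I M) (η : OneForm I M) : OneForm I M := fun x ↦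
  if h : DiffFormAt η x then
    TensorialAt.mkHom (fun Y : VField I M ↦
      mvfderiv I (fun y ↦ η y (Y y)) x (X x) - η x (mlieBracket I X Y x)) x (tensorialAt_lie X h)
  else 0

lemma lieDeriv_apply (X : VField I M) {η : OneForm I M} {x : M} (h : DiffFormAt η x)
    {Y : VField I M} (hY : MDiffAt (T% Y) x) :
    lieDeriv X η x (Y x) =
      mvfderiv I (fun y ↦ η y (Y y)) x (X x) - η x (mlieBracket I X Y x) := by
  rw [lieDeriv, dif_pos h]
  exact TensorialAt.mkHom_apply (tensorialAt_lie X h) hY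

/-- The expression `X(ξ(Y)) - Y(ξ(X)) - ξ([X, Y])` at the point `x`. -/
def dOneAux (ξ : OneForm I M) (x : M) (X Y : VField I M) : ℝ :=
  mvfderiv I (fun y ↦ ξ y (Y y)) x (X x) - mvfderiv I (fun y ↦ ξ y (X y)) x (Y x)
    - ξ x (mlieBracket I X Y x)

lemma tensorialAt_dOneAux_right {ξ : OneForm I M} {x : M} (h : DiffFormAt ξ x)
    (X : VField I M) : TensorialAt I E (dOneAux ξ x X) x where
  smul {f Y} hf hY := by
    have h1 := (tensorialAt_lie X h).smul hf hY
    simp only [dOneAux, Pi.smul_apply', map_smul] at h1 ⊢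
    rw [smul_sub, smul_sub]
    rw [smul_sub] at h1
    linarith
  add {Y Z} hY hZ := by
    have h1 := (tensorialAt_lie X h).add hY hZ
    simp only [dOneAux, Pi.add_apply, map_add] at h1 ⊢
    linarith

lemma dOneAux_swap (ξ : OneForm I M) (x : M) (X Y : VField I M) :
    dOneAux ξ x X Y = - dOneAux ξ x Y X := by
  rw [dOneAux, dOneAux, mlieBracket_swap_apply (V := X), map_neg]
  ring

lemma tensorialAt_dOneAux_left {ξ : OneForm I M} {x : M} (h : DiffFormAt ξ x)
    (Y : VField I M) : TensorialAt I E (fun X ↦ dOneAux ξ x X Y) x where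
  smul {f X} hf hX := by
    rw [dOneAux_swap, (tensorialAt_dOneAux_right h Y).smul hf hX, dOneAux_swap ξ x X, smul_neg]
  add {X Z} hX hZ := by
    rw [dOneAux_swap, (tensorialAt_dOneAux_right h Y).add hX hZ, dOneAux_swap ξ x X,
      dOneAux_swap ξ x Z]
    ring

open Classical in
/-- The exterior derivative `dξ` of a one-form, i.e. the two-form with
`dξ(X, Y) = X(ξ(Y)) - Y(ξ(X)) - ξ([X, Y])` (with the value `0` where `ξ` is not
differentiable). The contraction `i_Y dξ` is `dξ x (Y x)`. -/
def dOne (ξ : OneForm I M) : CovTensor I M := fun x ↦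
  if h : DiffFormAt ξ x then
    TensorialAt.mkHom₂ (dOneAux ξ x) x (fun Y _ ↦ tensorialAt_dOneAux_left h Y)
      (fun X _ ↦ tensorialAt_dOneAux_right h X)
  else 0

lemma dOne_apply {ξ : OneForm I M} {x : M} (h : DiffFormAt ξ x)
    {X Y : VField I M} (hX : MDiffAt (T% X) x) (hY : MDiffAt (T% Y) x) :
    dOne ξ x (X x) (Y x) =
      mvfderiv I (fun y ↦ ξ y (Y y)) x (X x) - mvfderiv I (fun y ↦ ξ y (X y)) x (Y x)
        - ξ x (mlieBracket I X Y x) := by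
  rw [dOne, dif_pos h]
  exact TensorialAt.mkHom₂_apply (fun Y _ ↦ tensorialAt_dOneAux_left h Y)
      (fun X _ ↦ tensorialAt_dOneAux_right h X) hX hY

/-! ### The standard Courant bracket and contractions -/

/-- The standard Courant bracket (in its Leibniz version)
`(X + ξ) ∘ (Y + η) = [X, Y] + (L_X η - i_Y dξ)` on sections of `A = TM ⊕ T*M`. -/
def courant (s t : ASection I M) : ASection I M := fun x ↦
  (mlieBracket I (fun y ↦ (s y).1) (fun y ↦ (t y).1) x,
    lieDeriv (fun y ↦ (s y).1) (fun y ↦ (t y).2) x - dOne (fun y ↦ (s y).2) x (t x).1)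

/-- The contracted product `s ∘_N t = N(s) ∘ t + s ∘ N(t) - N(s ∘ t)`. -/
def contracted (N : AEndField I M) (s t : ASection I M) : ASection I M := fun x ↦
  courant (fun y ↦ N y (s y)) t x + courant s (fun y ↦ N y (t y)) x - N x (courant s t x)

/-- The Nijenhuis torsion `T_N(s, t) = N(s) ∘ N(t) - N(s ∘_N t)`. -/
def torsion (N : AEndField I M) (s t : ASection I M) : ASection I M := fun x ↦
  courant (fun y ↦ N y (s y)) (fun y ↦ N y (t y)) x - N x (contracted N s t x)

variable (I) in
/-- The symmetric pairing `⟨X + ξ, Y + η⟩ = ⟨ξ, Y⟩ + ⟨η, X⟩` on `A = TM ⊕ T*M`. -/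
def pairing (x : M) (a b : Fibre I x) : ℝ := a.2 b.1 + b.2 a.1

/-- `N` is paired: `N + N* = c I` for some real constant `c`, where `N*` is the adjoint of `N`
with respect to the pairing. -/
def IsPaired (N : AEndField I M) : Prop :=
  ∃ (c : ℝ) (N' : AEndField I M),
    (∀ (x : M) (a b : Fibre I x), pairing I x (N x a) b = pairing I x a (N' x b)) ∧
    ∀ (x : M) (a : Fibre I x), N x a + N' x a = c • a

/-- The subbundle `TM` of `TM ⊕ T*M`. -/
def tangentSub (x : M) : Submodule ℝ (Fibre I x) := Submodule.prod ⊤ ⊥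

/-- The subbundle `T*M` of `TM ⊕ T*M`. -/
def cotangentSub (x : M) : Submodule ℝ (Fibre I x) := Submodule.prod ⊥ ⊤

/-- `N` is an outer Nijenhuis tensor for the subbundle `L` (with sections closed under the
Courant bracket): the smooth sections of `L` are closed under `∘_N` and the Nijenhuis torsion of
`N` vanishes on them. -/
def IsOuterNijenhuis (N : AEndField I M) (L : Π x : M, Submodule ℝ (Fibre I x)) : Prop :=
  ∀ s t : ASection I M, SmoothSection s → SmoothSection t → (∀ x, s x ∈ L x) → (∀ x, t x ∈ L x) →
    (∀ x, contracted N s t x ∈ L x) ∧ ∀ x, torsion N s t x = 0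

/-- `N` is a Lie bialgebroid-Nijenhuis tensor for the trivial Lie bialgebroid `(TM, T*M)`: a paired
`(1,1)`-tensor on `TM ⊕ T*M` that is an outer Nijenhuis tensor for both `TM` and `T*M`. -/
def IsLieBialgebroidNijenhuis (N : AEndField I M) : Prop :=
  SmoothAEnd N ∧ IsPaired N ∧
    IsOuterNijenhuis N (fun x ↦ tangentSub x) ∧ IsOuterNijenhuis N (fun x ↦ cotangentSub x)

/-! ### Nijenhuis, presymplectic-Nijenhuis and Poisson-Nijenhuis structures on `M` -/

/-- The contracted bracket `[X, Y]_{N₀} = [N₀X, Y] + [X, N₀Y] - N₀[X, Y]`. -/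
def bracketN (N₀ : EndField I M) (X Y : VField I M) : VField I M := fun x ↦
  mlieBracket I (fun y ↦ N₀ y (X y)) Y x + mlieBracket I X (fun y ↦ N₀ y (Y y)) x
    - N₀ x (mlieBracket I X Y x)

/-- `N₀` is a Nijenhuis tensor on `M`: a `(1,1)`-tensor with `[N₀X, N₀Y] = N₀[X, Y]_{N₀}`. -/
def IsNijenhuis (N₀ : EndField I M) : Prop :=
  SmoothEnd N₀ ∧ ∀ X Y : VField I M, SmoothVF X → SmoothVF Y → ∀ x,
    mlieBracket I (fun y ↦ N₀ y (X y)) (fun y ↦ N₀ y (Y y)) x - N₀ x (bracketN N₀ X Y x) = 0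

/-- The value `dΩ(X, Y, Z)` of the exterior derivative of a two-form. -/
def dTwo (Ω : CovTensor I M) (X Y Z : VField I M) (x : M) : ℝ :=
  mvfderiv I (fun y ↦ Ω y (Y y) (Z y)) x (X x) - mvfderiv I (fun y ↦ Ω y (X y) (Z y)) x (Y x)
    + mvfderiv I (fun y ↦ Ω y (X y) (Y y)) x (Z x)
    - Ω x (mlieBracket I X Y x) (Z x) + Ω x (mlieBracket I X Z x) (Y x)
    - Ω x (mlieBracket I Y Z x) (X x)

/-- `Ω` is a presymplectic structure: a smooth closed two-form (of arbitrary rank). -/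
def IsPresymplectic (Ω : CovTensor I M) : Prop :=
  SmoothCov Ω ∧ (∀ (x : M) (v w : TangentSpace I x), Ω x v w = - Ω x w v) ∧
    ∀ X Y Z : VField I M, SmoothVF X → SmoothVF Y → SmoothVF Z → ∀ x, dTwo Ω X Y Z x = 0

/-- `(N₀, Ω)` is a presymplectic-Nijenhuis structure: `N₀` is a Nijenhuis tensor, `Ω` is a closed
two-form, and `ΩN₀` is again a (skew-symmetric) closed two-form. -/
def IsPresymplecticNijenhuis (N₀ : EndField I M) (Ω : CovTensor I M) : Prop :=
  IsNijenhuis N₀ ∧ IsPresymplectic Ω ∧ IsPresymplectic (fun x ↦ (Ω x).comp (N₀ x))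

/-- The Poisson bracket `{f, g} = ⟨dg, Λ df⟩` of functions. -/
def poissonBracket (Λ : ContraTensor I M) (f g : M → ℝ) : M → ℝ := fun x ↦
  mvfderiv I g x (Λ x (mvfderiv I f x))

/-- `Λ` is a Poisson tensor: a smooth bivector field whose bracket of smooth functions satisfies
the Jacobi identity (equivalently, its Schouten square vanishes). -/
def IsPoisson (Λ : ContraTensor I M) : Prop :=
  SmoothContra Λ ∧ (∀ (x : M) (α β : Cotangent I x), β (Λ x α) = - α (Λ x β)) ∧
    ∀ f g h : M → ℝ, ContMDiff I 𝓘(ℝ, ℝ) ∞ f → ContMDiff I 𝓘(ℝ, ℝ) ∞ g →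
      ContMDiff I 𝓘(ℝ, ℝ) ∞ h → ∀ x,
        poissonBracket Λ f (poissonBracket Λ g h) x + poissonBracket Λ g (poissonBracket Λ h f) x
          + poissonBracket Λ h (poissonBracket Λ f g) x = 0

/-- The bracket `[ξ, η]^Λ = L_{Λξ} η - i_{Λη} dξ` of one-forms. -/
def formBracket (Λ : ContraTensor I M) (ξ η : OneForm I M) : OneForm I M := fun x ↦
  lieDeriv (fun y ↦ Λ y (ξ y)) η x - dOne ξ x (Λ x (η x))

/-- The dual map `ᵗN₀ : T*M → T*M` applied to a one-form. -/
def dualApply (N₀ : EndField I M) (ξ : OneForm I M) : OneForm I M := fun x ↦ (ξ x).comp (N₀ x)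

/-- `(N₀, Λ)` is a Poisson-Nijenhuis structure: `N₀` is a Nijenhuis tensor, `Λ` is a Poisson
tensor, `N₀Λ = Λ ᵗN₀` (i.e. `N₀Λ` is skew-symmetric), and the contraction of `[·, ·]^Λ` by `ᵗN₀`
coincides with `[·, ·]^{N₀Λ}`. -/
def IsPoissonNijenhuis (N₀ : EndField I M) (Λ : ContraTensor I M) : Prop :=
  IsNijenhuis N₀ ∧ IsPoisson Λ ∧
    (∀ (x : M) (α : Cotangent I x), N₀ x (Λ x α) = Λ x (α.comp (N₀ x))) ∧
    ∀ ξ η : OneForm I M, SmoothForm ξ → SmoothForm η → ∀ x,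
      formBracket Λ (dualApply N₀ ξ) η x + formBracket Λ ξ (dualApply N₀ η) x
          - dualApply N₀ (formBracket Λ ξ η) x
        = formBracket (fun x ↦ (N₀ x).comp (Λ x)) ξ η x

end

end CourantNijenhuis

end

namespace CourantNijenhuis

section

open Filter Topology

variable {E : Type*} [NormedAddCommGroup E] [NormedSpace ℝ E]
  {H : Type*} [TopologicalSpace H] {I : ModelWithCorners ℝ E H}
  {M : Type*} [TopologicalSpace M] [ChartedSpace H M]

/-! Being paired means that `N - (c/2) I` is skew for the pairing, which is exactly the displayed
block form with `Ω` and `Λ` skew. Subtracting a multiple of the identity does not change the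
torsion, and changes `s ∘_N t` only by a multiple of `s ∘ t`, which stays in `L`
(`isOuterNijenhuis_shift`). So it is enough to treat the skew part `P`.

For `L = TM`, the `T*M`-component of the contracted product is `dΩ(X, Y, ·)`, so closure means `dΩ =
0`. The torsion then has two components: the Nijenhuis torsion of `N₀`, and the one-form
`torsionForm`. The latter is `C^∞(M)`-linear in `X` only up to `df` times the symmetric part of
`ΩN₀`. Its vanishing therefore forces `ΩN₀` to be skew, after which it equals `-d(ΩN₀)`
(`isOuterNijenhuis_tangentSub_iff_presymplectic`).

For `L = T*M`, closure is automatic. The torsion has components `[Λξ, Λη] - Λ[ξ, η]^Λ`, a tensor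
that is the Jacobiator on exact forms, and `dualDefect`. The failure of linearity of `dualDefect` is
the symmetric part of `N₀Λ`, so its vanishing gives `N₀Λ = Λ ᵗN₀`; given that relation, it is the
defect of the bracket compatibility (`isOuterNijenhuis_cotangentSub_iff_poisson`). -/

lemma natCast_le_infty (n : ℕ) : (n : ℕ∞ω) ≤ ∞ := mod_cast (le_top : (n : ℕ∞) ≤ ⊤)

/-- Smooth real-valued functions on `M`. -/
abbrev SmoothFun (I : ModelWithCorners ℝ E H) (f : M → ℝ) : Prop := ContMDiff I 𝓘(ℝ, ℝ) ∞ f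

/-- The derivative `X f` of the function `f` along the vector field `X`. -/
noncomputable abbrev dirDeriv (X : VField I M) (f : M → ℝ) : M → ℝ :=
  fun y ↦ mvfderiv I f y (X y)

lemma SmoothFun.mdiff {f : M → ℝ} (hf : SmoothFun I f) (x : M) :
    MDifferentiableAt I 𝓘(ℝ, ℝ) f x :=
  (hf x).mdifferentiableAt (by simp)

lemma mvfderiv_congr {f g : M → ℝ} {x : M} (h : f =ᶠ[𝓝 x] g) :
    mvfderiv I f x = mvfderiv I g x := by
  ext v
  simp only [mvfderiv, ContinuousLinearMap.comp_apply]
  rw [h.mfderiv_eq]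
  rfl

/-! ### Smooth sections: module operations, contraction, differentials. -/

variable [IsManifold I ∞ M]

lemma SmoothVF.mdiff {X : VField I M} (hX : SmoothVF X) (x : M) : MDiffAt (T% X) x :=
  (hX x).mdifferentiableAt (by simp)

lemma SmoothVF.add {X Y : VField I M} (hX : SmoothVF X) (hY : SmoothVF Y) :
    SmoothVF (fun x ↦ X x + Y x) := ContMDiff.add_section hX hY

lemma SmoothVF.sub {X Y : VField I M} (hX : SmoothVF X) (hY : SmoothVF Y) :
    SmoothVF (fun x ↦ X x - Y x) := ContMDiff.sub_section hX hY

lemma SmoothVF.smul {f : M → ℝ} {X : VField I M} (hf : SmoothFun I f) (hX : SmoothVF X) :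
    SmoothVF (fun x ↦ f x • X x) := ContMDiff.smul_section hf hX

lemma SmoothVF.const_smul {X : VField I M} (c : ℝ) (hX : SmoothVF X) :
    SmoothVF (fun x ↦ c • X x) := ContMDiff.const_smul_section (a := c) hX

lemma SmoothVF.zero : SmoothVF (fun _ ↦ 0 : VField I M) :=
  contMDiff_zeroSection ℝ (fun x : M ↦ TangentSpace I x)

lemma SmoothVF.sum {ι : Type*} {s : Finset ι} {X : ι → VField I M} (h : ∀ i, SmoothVF (X i)) :
    SmoothVF (fun x ↦ ∑ i ∈ s, X i x) := ContMDiff.sum_section fun i _ ↦ h i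

lemma SmoothForm.add {ξ η : OneForm I M} (hξ : SmoothForm ξ) (hη : SmoothForm η) :
    SmoothForm (fun x ↦ ξ x + η x) := ContMDiff.add_section hξ hη

lemma SmoothForm.neg {ξ : OneForm I M} (hξ : SmoothForm ξ) : SmoothForm (fun x ↦ - ξ x) :=
  ContMDiff.neg_section hξ

lemma SmoothForm.sub {ξ η : OneForm I M} (hξ : SmoothForm ξ) (hη : SmoothForm η) :
    SmoothForm (fun x ↦ ξ x - η x) := ContMDiff.sub_section hξ hη

lemma SmoothForm.smul {f : M → ℝ} {ξ : OneForm I M} (hf : SmoothFun I f) (hξ : SmoothForm ξ) :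
    SmoothForm (fun x ↦ f x • ξ x) := ContMDiff.smul_section hf hξ

lemma SmoothForm.const_smul {ξ : OneForm I M} (c : ℝ) (hξ : SmoothForm ξ) :
    SmoothForm (fun x ↦ c • ξ x) := ContMDiff.const_smul_section (a := c) hξ

lemma SmoothForm.zero : SmoothForm (fun _ ↦ 0 : OneForm I M) :=
  contMDiff_zeroSection ℝ (fun x : M ↦ TangentSpace I x →L[ℝ] Bundle.Trivial M ℝ x)

lemma SmoothForm.sum {ι : Type*} {s : Finset ι} {ξ : ι → OneForm I M}
    (h : ∀ i, SmoothForm (ξ i)) :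
    SmoothForm (fun x ↦ ∑ i ∈ s, ξ i x) := ContMDiff.sum_section fun i _ ↦ h i

lemma SmoothForm.apply {ξ : OneForm I M} {X : VField I M} (hξ : SmoothForm ξ)
    (hX : SmoothVF X) : SmoothFun I (fun y ↦ ξ y (X y)) := by
  intro x
  have := ContMDiffAt.clm_bundle_apply (E₁ := fun x : M ↦ TangentSpace I x)
    (E₂ := Bundle.Trivial M ℝ) (b := fun x : M ↦ x) (hξ x) (hX x)
  rw [contMDiffAt_totalSpace] at this
  exact this.2

/-- The differential of a smooth function is a smooth one-form. -/
lemma SmoothFun.smoothForm {f : M → ℝ} (hf : SmoothFun I f) : SmoothForm (mvfderiv I f) := by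
  intro x
  rw [contMDiffAt_hom_bundle]
  refine ⟨contMDiffAt_id, ?_⟩
  have h := (hf x).mfderiv_const (m := ∞) (by simp)
  refine h.congr_of_eventuallyEq (Eventually.of_forall fun y ↦ ?_)
  ext v
  simp [inTangentCoordinates, ContinuousLinearMap.inCoordinates, mvfderiv]
  rfl

lemma SmoothFun.dirDeriv {X : VField I M} {f : M → ℝ} (hX : SmoothVF X) (hf : SmoothFun I f) :
    SmoothFun I (dirDeriv X f) := hf.smoothForm.apply hX

variable [FiniteDimensional ℝ E]

lemma SmoothVF.bracket {X Y : VField I M} (hX : SmoothVF X) (hY : SmoothVF Y) :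
    SmoothVF (mlieBracket I X Y) := by
  intro x
  have : IsManifold I (((⊤ : ℕ∞) : ℕ∞ω) + 1) M := by simpa
  have : IsManifold I (minSmoothness ℝ 2) M :=
    .of_le (n := ∞) (by simpa using natCast_le_infty 2)
  exact ContMDiffAt.mlieBracket_vectorField (m := (⊤ : ℕ∞)) (n := (⊤ : ℕ∞)) (hX x) (hY x) (by simp)

/-! ### Global coordinate-like functions, extension of pointwise data, brackets as commutators. -/

variable [T2Space M]

/-- Near every point there are globally defined smooth functions and smooth vector fields which
behave like coordinates and the corresponding frame. -/
lemma exists_coordinates (x : M) :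
    ∃ (g : Fin (Module.finrank ℝ E) → M → ℝ) (X : Fin (Module.finrank ℝ E) → VField I M),
      (∀ i, SmoothFun I (g i)) ∧ (∀ i, SmoothVF (X i)) ∧
        ∀ᶠ y in 𝓝 x, ∀ v : TangentSpace I y, v = ∑ i, mvfderiv I (g i) y v • X i y := by
  let b := Module.finBasis ℝ E
  obtain ⟨f⟩ : Nonempty (SmoothBumpFunction I x) := inferInstance
  let t := trivializationAt E (TangentSpace I) x
  let co : Fin (Module.finrank ℝ E) → E →L[ℝ] ℝ := fun i ↦ (b.coord i).toContinuousLinearMap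
  -- Chart coordinates and the coordinate frame, both cut off by a bump function equal to `1` near
  -- `x`.
  refine ⟨fun i y ↦ f y • co i (extChartAt I x y), fun i ↦ (f : M → ℝ) • t.localFrame b i,
    fun i ↦ ?_, fun i ↦ ?_, ?_⟩
  · apply f.contMDiff_smul
    exact (co i).contMDiff.comp_contMDiffOn contMDiffOn_extChartAt
  · refine ContMDiffOn.smul_section_of_tsupport (u := t.baseSet) f.contMDiff.contMDiffOn
      t.open_baseSet ?_ (t.contMDiffOn_localFrame_baseSet ∞ b i)
    simpa [t] using f.tsupport_subset_chartAt_source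
  -- A derivative at `y` sees the germ there, so the bump function has to be `1` on a neighbourhood
  -- of each nearby `y`, not only at `y`.
  · have h1 := f.eventuallyEq_one.eventually_nhds
    have h2 : ∀ᶠ y in 𝓝 x, y ∈ (chartAt H x).source :=
      (chartAt H x).open_source.mem_nhds (mem_chart_source H x)
    filter_upwards [h1, h2] with y hy1 hy2 v
    have hyt : y ∈ t.baseSet := by simpa [t] using hy2
    have hD : ∀ i, mvfderiv I (fun y ↦ f y • co i (extChartAt I x y)) y v
        = co i (t.continuousLinearMapAt ℝ y v) := by
      intro i
      rw [mvfderiv_congr (g := co i ∘ extChartAt I x)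
        (by filter_upwards [hy1] with z hz; simp [hz])]
      rw [mvfderiv_comp_apply y (co i).mdifferentiableAt (mdifferentiableAt_extChartAt hy2),
        TangentBundle.continuousLinearMapAt_trivializationAt hy2]
      simp [mvfderiv]
      rfl
    have hf1 : f y = 1 := hy1.self_of_nhds
    simp only [hD, Pi.smul_apply', hf1, one_smul]
    conv_lhs => rw [← (t.basisAt b hyt).sum_repr v]
    refine Finset.sum_congr rfl fun i _ ↦ ?_
    rw [t.localFrame_apply_of_mem_baseSet b hyt]
    congr 1
    simp [Trivialization.basisAt, co, Trivialization.continuousLinearMapAt_apply, hyt]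

/-- Every tangent vector extends to a smooth vector field. -/
lemma exists_smoothVF_eq (x : M) (v : TangentSpace I x) :
    ∃ X : VField I M, SmoothVF X ∧ X x = v := by
  obtain ⟨g, X, -, hX, h⟩ := exists_coordinates (I := I) x
  exact ⟨fun y ↦ ∑ i, mvfderiv I (g i) x v • X i y, .sum fun i ↦ (hX i).const_smul _,
    (h.self_of_nhds v).symm⟩

omit [IsManifold I ∞ M] [FiniteDimensional ℝ E] [T2Space M] in
lemma mvfderiv_sum_const_smul {ι : Type*} (s : Finset ι) (c : ι → ℝ) {g : ι → M → ℝ}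
    (hg : ∀ i, SmoothFun I (g i)) (x : M) :
    SmoothFun I (fun y ↦ ∑ i ∈ s, c i * g i y) ∧
      mvfderiv I (fun y ↦ ∑ i ∈ s, c i * g i y) x = ∑ i ∈ s, c i • mvfderiv I (g i) x := by
  classical
  have hs : ∀ s : Finset ι, SmoothFun I (fun y ↦ ∑ i ∈ s, c i * g i y) := fun s ↦
    contMDiff_finsetSum fun i _ ↦ contMDiff_const.mul (hg i)
  have hs1 : ∀ i, SmoothFun I (fun y ↦ c i * g i y) := fun i ↦ contMDiff_const.mul (hg i)
  refine ⟨hs s, ?_⟩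
  induction s using Finset.induction_on with
  | empty => simp [mvfderiv_const]
  | insert i s hi ih =>
    simp only [Finset.sum_insert hi]
    rw [mvfderiv_fun_add ((hs1 i).mdiff x) ((hs s).mdiff x), ih,
      mvfderiv_fun_mul mdifferentiableAt_const ((hg i).mdiff x)]
    simp [mvfderiv_const]

/-- Every covector is the differential of a globally defined smooth function. -/
lemma exists_smoothFun_mvfderiv_eq (x : M) (α : Cotangent I x) :
    ∃ f : M → ℝ, SmoothFun I f ∧ mvfderiv I f x = α := by
  obtain ⟨g, X, hg, -, h⟩ := exists_coordinates (I := I) x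
  obtain ⟨h1, h2⟩ := mvfderiv_sum_const_smul Finset.univ (fun i ↦ α (X i x)) hg x
  refine ⟨_, h1, h2.trans ?_⟩
  ext v
  conv_rhs => rw [h.self_of_nhds v]
  simp [mul_comm]

lemma exists_smoothForm_eq (x : M) (α : Cotangent I x) :
    ∃ ξ : OneForm I M, SmoothForm ξ ∧ ξ x = α := by
  obtain ⟨f, hf, h⟩ := exists_smoothFun_mvfderiv_eq x α
  exact ⟨_, hf.smoothForm, h⟩

lemma exists_mvfderiv_apply_eq_one {x : M} {v : TangentSpace I x} (hv : v ≠ 0) :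
    ∃ f : M → ℝ, SmoothFun I f ∧ mvfderiv I f x v = 1 := by
  obtain ⟨g, X, hg, -, h⟩ := exists_coordinates (I := I) x
  obtain ⟨i, hi⟩ : ∃ i, mvfderiv I (g i) x v ≠ 0 := by
    by_contra! hcon
    exact hv (by rw [h.self_of_nhds v]; simp [hcon])
  obtain ⟨f, hf, h⟩ := exists_smoothFun_mvfderiv_eq x
    ((mvfderiv I (g i) x v)⁻¹ • mvfderiv I (g i) x)
  exact ⟨f, hf, by simp [h, hi]⟩

/-- A one-form is smooth if its values on all smooth vector fields are smooth. -/
lemma smoothForm_of_apply {ξ : OneForm I M}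
    (h : ∀ X : VField I M, SmoothVF X → SmoothFun I (fun y ↦ ξ y (X y))) : SmoothForm ξ := by
  intro x
  obtain ⟨g, X, hg, hX, hgX⟩ := exists_coordinates (I := I) x
  -- Near `x` the form `ξ` is `∑ ξ(X i) d(g i)`, and the coefficients are smooth by hypothesis.
  have hs : SmoothForm (fun y ↦ ∑ i, ξ y (X i y) • mvfderiv I (g i) y) :=
    .sum fun i ↦ .smul (h _ (hX i)) (hg i).smoothForm
  refine (hs x).congr_of_eventuallyEq ?_
  filter_upwards [hgX] with y hy
  congr 1
  ext v
  conv_lhs => rw [hy v]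
  simp [mul_comm]

/-- A `C^∞(M)`-linear functional on smooth one-forms, with values at the point `x`, vanishes if it
vanishes on exact forms. -/
lemma eq_zero_of_exact {A : Type*} [AddCommGroup A] [Module ℝ A] {x : M} {Φ : OneForm I M → A}
    (hadd : ∀ ξ η, SmoothForm ξ → SmoothForm η → Φ (fun y ↦ ξ y + η y) = Φ ξ + Φ η)
    (hsmul : ∀ f ξ, SmoothFun I f → SmoothForm ξ → Φ (fun y ↦ f y • ξ y) = f x • Φ ξ)
    (hex : ∀ f : M → ℝ, SmoothFun I f → Φ (mvfderiv I f) = 0)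
    {ξ : OneForm I M} (hξ : SmoothForm ξ) : Φ ξ = 0 := by
  classical
  obtain ⟨g, X, hg, hX, hgX⟩ := exists_coordinates (I := I) x
  -- With `ψ` supported where the frame expansion holds, `ψ ξ = ∑ (ψ ξ(X i)) d(g i)` is a global
  -- identity, and `Φ (ψ ξ) = Φ ξ` because `ψ x = 1`.
  obtain ⟨ψ, -, hψ⟩ := ((SmoothBumpFunction.nhds_basis_tsupport (I := I) x).mem_iff' _).1 hgX
  have h0 : Φ (fun _ ↦ 0) = 0 := by
    have := hsmul 0 (fun _ ↦ 0) contMDiff_const .zero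
    simpa using this
  have hcoef : ∀ i, SmoothFun I fun y ↦ ψ y * ξ y (X i y) := fun i ↦
    ψ.contMDiff.mul (hξ.apply (hX i))
  have hsum : ∀ s : Finset (Fin (Module.finrank ℝ E)),
      Φ (fun y ↦ ∑ i ∈ s, (ψ y * ξ y (X i y)) • mvfderiv I (g i) y) = 0 := by
    intro s
    induction s using Finset.induction_on with
    | empty => simpa using h0
    | insert i s hi ih =>
      simp only [Finset.sum_insert hi]
      rw [hadd _ _ (.smul (hcoef i) (hg i).smoothForm)
        (.sum fun i ↦ .smul (hcoef i) (hg i).smoothForm), ih,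
        hsmul _ _ (hcoef i) (hg i).smoothForm, hex _ (hg i)]
      simp
  have h1 := hsmul ψ ξ ψ.contMDiff hξ
  rw [ψ.eq_one, one_smul] at h1
  rw [← h1, ← hsum Finset.univ]
  congr 1
  ext y v
  by_cases hy : y ∈ tsupport ψ
  · have := hψ hy v
    conv_lhs => rw [this]
    simp [mul_comm, mul_left_comm]
  · simp [image_eq_zero_of_notMem_tsupport hy]

/-- The Lie bracket of vector fields is the commutator of the associated derivations. -/
lemma mvfderiv_mlieBracket {X Y : VField I M} {f : M → ℝ} (hX : SmoothVF X) (hY : SmoothVF Y)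
    (hf : SmoothFun I f) (x : M) :
    mvfderiv I f x (mlieBracket I X Y x)
      = dirDeriv X (dirDeriv Y f) x - dirDeriv Y (dirDeriv X f) x := by
  -- The argument needs a field `W` with `W x ≠ 0`. The Jacobi identity for `X, Y, f W`, minus `f`
  -- times the one for `X, Y, W`, leaves the desired difference times `W x`.
  by_cases hv : ∀ v : TangentSpace I x, v = 0
  · simp [hv (mlieBracket I X Y x), dirDeriv, hv (X x), hv (Y x)]
  push Not at hv
  obtain ⟨w, hw⟩ := hv
  obtain ⟨W, hW, rfl⟩ := exists_smoothVF_eq x w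
  have : IsManifold I (minSmoothness ℝ 3) M :=
    .of_le (n := ∞) (by simpa using natCast_le_infty 3)
  have hfW := SmoothVF.smul hf hW
  have le : ∀ {Z : VField I M}, SmoothVF Z → CMDiff (minSmoothness ℝ 2) (T% Z) :=
    fun h ↦ h.of_le (by simpa using natCast_le_infty 2)
  have key : ∀ {Z : VField I M}, SmoothVF Z → mlieBracket I Z (f • W)
      = (dirDeriv Z f • W) + (f • mlieBracket I Z W) := by
    intro Z hZ
    ext y
    exact mlieBracket_smul_right (hf.mdiff y) (hW.mdiff y)
  have key2 : ∀ {Z Z' : VField I M}, SmoothVF Z → SmoothVF Z' →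
      mlieBracket I Z (mlieBracket I Z' (f • W)) x
      = dirDeriv Z (dirDeriv Z' f) x • W x + dirDeriv Z' f x • mlieBracket I Z W x
        + (dirDeriv Z f x • mlieBracket I Z' W x + f x • mlieBracket I Z (mlieBracket I Z' W) x) := by
    intro Z Z' hZ hZ'
    rw [key hZ', mlieBracket_add_right (W := dirDeriv Z' f • W) (W₁ := f • mlieBracket I Z' W)
      ((SmoothVF.smul (hf.dirDeriv hZ') hW).mdiff x)
      ((SmoothVF.smul hf (hZ'.bracket hW)).mdiff x),
      mlieBracket_smul_right ((hf.dirDeriv hZ').mdiff x) (hW.mdiff x),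
      mlieBracket_smul_right (hf.mdiff x) ((hZ'.bracket hW).mdiff x)]
  have h1 := leibniz_identity_mlieBracket_apply (x := x) (le hX x) (le hY x) (le hfW x)
  have h2 := leibniz_identity_mlieBracket_apply (x := x) (le hX x) (le hY x) (le hW x)
  change mlieBracket I X (mlieBracket I Y (f • W)) x =
    mlieBracket I (mlieBracket I X Y) (f • W) x + mlieBracket I Y (mlieBracket I X (f • W)) x at h1
  rw [key2 hX hY, key2 hY hX, key (hX.bracket hY), h2] at h1
  simp only [Pi.add_apply, Pi.smul_apply'] at h1
  have h3 : (mvfderiv I f x (mlieBracket I X Y x)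
      - (dirDeriv X (dirDeriv Y f) x - dirDeriv Y (dirDeriv X f) x)) • W x = 0 := by
    have h4 : dirDeriv (mlieBracket I X Y) f x = mvfderiv I f x (mlieBracket I X Y x) := rfl
    rw [h4] at h1
    rw [← sub_eq_zero] at h1
    rw [← neg_eq_zero, ← h1]
    module
  exact sub_eq_zero.1 ((smul_eq_zero.1 h3).resolve_right hw)

/-! ### Calculus of smooth vector fields and one-forms -/

omit [T2Space M] in
lemma SmoothForm.lieDeriv_apply {η : OneForm I M} {Z : VField I M} (hη : SmoothForm η)
    (X : VField I M) (hZ : SmoothVF Z) (x : M) :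
    lieDeriv X η x (Z x) =
      mvfderiv I (fun y ↦ η y (Z y)) x (X x) - η x (mlieBracket I X Z x) :=
  CourantNijenhuis.lieDeriv_apply X (hη.diffFormAt x) (hZ.mdiff x)

omit [T2Space M] in
lemma SmoothForm.dOne_apply {ξ : OneForm I M} {X Y : VField I M} (hξ : SmoothForm ξ)
    (hX : SmoothVF X) (hY : SmoothVF Y) (x : M) :
    dOne ξ x (X x) (Y x) =
      mvfderiv I (fun y ↦ ξ y (Y y)) x (X x) - mvfderiv I (fun y ↦ ξ y (X y)) x (Y x)
        - ξ x (mlieBracket I X Y x) :=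
  CourantNijenhuis.dOne_apply (hξ.diffFormAt x) (hX.mdiff x) (hY.mdiff x)

/-- Two covectors agree if they agree on all smooth vector fields. -/
lemma cotangent_ext {x : M} {α β : Cotangent I x}
    (h : ∀ Z : VField I M, SmoothVF Z → α (Z x) = β (Z x)) : α = β := by
  ext v
  obtain ⟨Z, hZ, rfl⟩ := exists_smoothVF_eq x v
  exact h Z hZ

/-- A tangent vector vanishes if it annihilates all smooth functions. -/
lemma tangent_eq_zero {x : M} {v : TangentSpace I x}
    (h : ∀ f : M → ℝ, SmoothFun I f → mvfderiv I f x v = 0) : v = 0 := by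
  by_contra hv
  obtain ⟨f, hf, h1⟩ := exists_mvfderiv_apply_eq_one hv
  exact one_ne_zero (h1.symm.trans (h f hf))

omit [T2Space M] in
lemma mlieBracket_fun_add_left {X X' Y : VField I M} (hX : SmoothVF X) (hX' : SmoothVF X')
    (x : M) : mlieBracket I (fun y ↦ X y + X' y) Y x
      = mlieBracket I X Y x + mlieBracket I X' Y x :=
  mlieBracket_add_left (hX.mdiff x) (hX'.mdiff x)

omit [T2Space M] in
lemma mlieBracket_fun_add_right {X Y Y' : VField I M} (hY : SmoothVF Y) (hY' : SmoothVF Y')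
    (x : M) : mlieBracket I X (fun y ↦ Y y + Y' y) x
      = mlieBracket I X Y x + mlieBracket I X Y' x :=
  mlieBracket_add_right (hY.mdiff x) (hY'.mdiff x)

omit [T2Space M] in
lemma mlieBracket_fun_smul_left {f : M → ℝ} {X Y : VField I M} (hf : SmoothFun I f)
    (hX : SmoothVF X) (x : M) : mlieBracket I (fun y ↦ f y • X y) Y x
      = f x • mlieBracket I X Y x - mvfderiv I f x (Y x) • X x := by
  have := mlieBracket_smul_left (W := Y) (hf.mdiff x) (hX.mdiff x)
  refine this.trans ?_
  module

omit [T2Space M] in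
lemma mlieBracket_fun_smul_right {f : M → ℝ} {X Y : VField I M} (hf : SmoothFun I f)
    (hY : SmoothVF Y) (x : M) : mlieBracket I X (fun y ↦ f y • Y y) x
      = f x • mlieBracket I X Y x + mvfderiv I f x (X x) • Y x := by
  have := mlieBracket_smul_right (V := X) (hf.mdiff x) (hY.mdiff x)
  refine this.trans ?_
  module

omit [T2Space M] in
lemma mlieBracket_fun_const_smul_left (c : ℝ) {X Y : VField I M}
    (hX : SmoothVF X) (x : M) : mlieBracket I (fun y ↦ c • X y) Y x
      = c • mlieBracket I X Y x := mlieBracket_const_smul_left (hX.mdiff x)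

omit [T2Space M] in
lemma mlieBracket_fun_const_smul_right (c : ℝ) {X Y : VField I M}
    (hY : SmoothVF Y) (x : M) : mlieBracket I X (fun y ↦ c • Y y) x
      = c • mlieBracket I X Y x := mlieBracket_const_smul_right (hY.mdiff x)

lemma lieDeriv_add_left {X X' : VField I M} {η : OneForm I M} (hX : SmoothVF X)
    (hX' : SmoothVF X') (hη : SmoothForm η) (x : M) :
    lieDeriv (fun y ↦ X y + X' y) η x = lieDeriv X η x + lieDeriv X' η x := by
  refine cotangent_ext fun Z hZ ↦ ?_
  simp only [add_apply, hη.lieDeriv_apply _ hZ, map_add,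
    mlieBracket_fun_add_left hX hX']
  ring

lemma lieDeriv_add_right {X : VField I M} {η η' : OneForm I M}
    (hη : SmoothForm η) (hη' : SmoothForm η') (x : M) :
    lieDeriv X (fun y ↦ η y + η' y) x = lieDeriv X η x + lieDeriv X η' x := by
  refine cotangent_ext fun Z hZ ↦ ?_
  simp only [add_apply, hη.lieDeriv_apply _ hZ, hη'.lieDeriv_apply _ hZ,
    (hη.add hη').lieDeriv_apply _ hZ]
  rw [mvfderiv_fun_add ((hη.apply hZ).mdiff x) ((hη'.apply hZ).mdiff x)]
  simp only [add_apply]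
  ring

lemma lieDeriv_smul_left {f : M → ℝ} {X : VField I M} {η : OneForm I M} (hf : SmoothFun I f)
    (hX : SmoothVF X) (hη : SmoothForm η) (x : M) :
    lieDeriv (fun y ↦ f y • X y) η x = f x • lieDeriv X η x + η x (X x) • mvfderiv I f x := by
  refine cotangent_ext fun Z hZ ↦ ?_
  simp only [add_apply, smul_apply,
    hη.lieDeriv_apply _ hZ, map_smul, mlieBracket_fun_smul_left hf hX, map_sub, smul_eq_mul]
  ring

lemma lieDeriv_smul_right {f : M → ℝ} {X : VField I M} {η : OneForm I M} (hf : SmoothFun I f)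
    (hη : SmoothForm η) (x : M) :
    lieDeriv X (fun y ↦ f y • η y) x = f x • lieDeriv X η x + mvfderiv I f x (X x) • η x := by
  refine cotangent_ext fun Z hZ ↦ ?_
  simp only [add_apply, smul_apply,
    hη.lieDeriv_apply _ hZ, (SmoothForm.smul hf hη).lieDeriv_apply _ hZ, smul_eq_mul]
  rw [mvfderiv_fun_mul (hf.mdiff x) ((hη.apply hZ).mdiff x)]
  simp only [add_apply, smul_apply, smul_eq_mul]
  ring

lemma dOne_add {ξ ξ' : OneForm I M} (hξ : SmoothForm ξ) (hξ' : SmoothForm ξ') (x : M) :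
    dOne (fun y ↦ ξ y + ξ' y) x = dOne ξ x + dOne ξ' x := by
  ext1 v
  obtain ⟨X, hX, rfl⟩ := exists_smoothVF_eq x v
  refine cotangent_ext fun Z hZ ↦ ?_
  simp only [add_apply, hξ.dOne_apply hX hZ, hξ'.dOne_apply hX hZ,
    (hξ.add hξ').dOne_apply hX hZ]
  rw [mvfderiv_fun_add ((hξ.apply hZ).mdiff x) ((hξ'.apply hZ).mdiff x),
    mvfderiv_fun_add ((hξ.apply hX).mdiff x) ((hξ'.apply hX).mdiff x)]
  simp only [add_apply]
  ring

lemma dOne_smul {f : M → ℝ} {ξ : OneForm I M} (hf : SmoothFun I f) (hξ : SmoothForm ξ) (x : M)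
    (v : TangentSpace I x) :
    dOne (fun y ↦ f y • ξ y) x v
      = f x • dOne ξ x v + mvfderiv I f x v • ξ x - ξ x v • mvfderiv I f x := by
  obtain ⟨X, hX, rfl⟩ := exists_smoothVF_eq x v
  refine cotangent_ext fun Z hZ ↦ ?_
  simp only [add_apply, sub_apply,
    smul_apply, hξ.dOne_apply hX hZ,
    (SmoothForm.smul hf hξ).dOne_apply hX hZ, smul_eq_mul]
  rw [mvfderiv_fun_mul (hf.mdiff x) ((hξ.apply hZ).mdiff x),
    mvfderiv_fun_mul (hf.mdiff x) ((hξ.apply hX).mdiff x)]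
  simp only [add_apply, smul_apply, smul_eq_mul]
  ring

lemma lieDeriv_const_smul_left (c : ℝ) {X : VField I M} {η : OneForm I M}
    (hX : SmoothVF X) (hη : SmoothForm η) (x : M) :
    lieDeriv (fun y ↦ c • X y) η x = c • lieDeriv X η x := by
  simpa [mvfderiv_const] using lieDeriv_smul_left (f := fun _ ↦ c) contMDiff_const hX hη x

lemma lieDeriv_const_smul_right (c : ℝ) {X : VField I M} {η : OneForm I M}
    (hη : SmoothForm η) (x : M) :
    lieDeriv X (fun y ↦ c • η y) x = c • lieDeriv X η x := by
  simpa [mvfderiv_const] using lieDeriv_smul_right (f := fun _ ↦ c) contMDiff_const hη x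

lemma dOne_const_smul (c : ℝ) {ξ : OneForm I M} (hξ : SmoothForm ξ) (x : M) :
    dOne (fun y ↦ c • ξ y) x = c • dOne ξ x := by
  ext1 v
  simpa [mvfderiv_const] using dOne_smul (f := fun _ ↦ c) contMDiff_const hξ x v

lemma lieDeriv_neg_right {X : VField I M} {η : OneForm I M} (hη : SmoothForm η) (x : M) :
    lieDeriv X (fun y ↦ - η y) x = - lieDeriv X η x := by
  have h : (fun y ↦ - η y) = fun y ↦ (-1 : ℝ) • η y := by ext; simp
  rw [h, lieDeriv_const_smul_right _ hη]
  ext; simp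

lemma dOne_neg {ξ : OneForm I M} (hξ : SmoothForm ξ) (x : M) :
    dOne (fun y ↦ - ξ y) x = - dOne ξ x := by
  have h : (fun y ↦ - ξ y) = fun y ↦ (-1 : ℝ) • ξ y := by ext; simp
  rw [h, dOne_const_smul _ hξ]
  ext; simp

lemma lieDeriv_zero_left {η : OneForm I M} (hη : SmoothForm η) (x : M) :
    lieDeriv (fun _ ↦ 0) η x = 0 := by
  simpa using lieDeriv_const_smul_left 0 .zero hη x

lemma lieDeriv_zero_right (X : VField I M) (x : M) :
    lieDeriv X (fun _ ↦ 0 : OneForm I M) x = 0 := by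
  simpa using lieDeriv_const_smul_right 0 (X := X) .zero x

lemma dOne_zero (x : M) : dOne (fun _ ↦ 0 : OneForm I M) x = 0 := by
  ext v w
  have h := dOne_const_smul 0 (.zero : SmoothForm (fun _ ↦ 0 : OneForm I M)) x
  simp only [smul_zero] at h
  rw [h]
  simp

/-- Exact one-forms are closed. -/
lemma dOne_mvfderiv {f : M → ℝ} (hf : SmoothFun I f) (x : M) : dOne (mvfderiv I f) x = 0 := by
  ext1 v
  obtain ⟨X, hX, rfl⟩ := exists_smoothVF_eq x v
  refine cotangent_ext fun Z hZ ↦ ?_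
  rw [hf.smoothForm.dOne_apply hX hZ, mvfderiv_mlieBracket hX hZ hf]
  simp [dirDeriv]

/-- The Lie derivative commutes with the differential of functions. -/
lemma lieDeriv_mvfderiv {X : VField I M} {f : M → ℝ} (hX : SmoothVF X) (hf : SmoothFun I f)
    (x : M) : lieDeriv X (mvfderiv I f) x = mvfderiv I (dirDeriv X f) x := by
  refine cotangent_ext fun Z hZ ↦ ?_
  rw [hf.smoothForm.lieDeriv_apply X hZ, mvfderiv_mlieBracket hX hZ hf]
  simp [dirDeriv]

omit [IsManifold I ∞ M] [FiniteDimensional ℝ E] [T2Space M] in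
lemma mlieBracket_fun_zero_left (Y : VField I M) (x : M) :
    mlieBracket I (fun _ ↦ 0 : VField I M) Y x = 0 :=
  congrFun (mlieBracket_zero_left (I := I) (W := Y)) x

omit [IsManifold I ∞ M] [FiniteDimensional ℝ E] [T2Space M] in
lemma mlieBracket_fun_zero_right (X : VField I M) (x : M) :
    mlieBracket I X (fun _ ↦ 0 : VField I M) x = 0 :=
  congrFun (mlieBracket_zero_right (I := I) (W := X)) x

/-! ### Smoothness of tensor fields -/

lemma SmoothEnd.dualApply {N₀ : EndField I M} (h : SmoothEnd N₀) {ξ : OneForm I M}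
    (hξ : SmoothForm ξ) : SmoothForm (dualApply N₀ ξ) :=
  smoothForm_of_apply fun _ hX ↦ hξ.apply (h _ hX)

/-! ### Shifting a tensor by a multiple of the identity -/

omit [FiniteDimensional ℝ E] [T2Space M] in
lemma SmoothSection.add {s t : ASection I M} (hs : SmoothSection s) (ht : SmoothSection t) :
    SmoothSection (fun x ↦ s x + t x) := ⟨hs.1.add ht.1, hs.2.add ht.2⟩

omit [FiniteDimensional ℝ E] [T2Space M] in
lemma SmoothSection.const_smul {s : ASection I M} (c : ℝ) (hs : SmoothSection s) :
    SmoothSection (fun x ↦ c • s x) := ⟨hs.1.const_smul c, hs.2.const_smul c⟩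

lemma courant_add_smul_left (c : ℝ) {s s' t : ASection I M} (hs : SmoothSection s)
    (hs' : SmoothSection s') (ht : SmoothSection t) (x : M) :
    courant (fun y ↦ c • s y + s' y) t x = c • courant s t x + courant s' t x := by
  ext1
  · simp only [courant, Prod.fst_add, Prod.smul_fst]
    rw [mlieBracket_fun_add_left (hs.1.const_smul c) hs'.1,
      mlieBracket_fun_const_smul_left c hs.1]
  · simp only [courant, Prod.snd_add, Prod.smul_snd, Prod.fst_add, Prod.smul_fst]
    rw [lieDeriv_add_left (hs.1.const_smul c) hs'.1 ht.2, lieDeriv_const_smul_left c hs.1 ht.2,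
      dOne_add (hs.2.const_smul c) hs'.2, dOne_const_smul c hs.2]
    simp only [add_apply, smul_apply]
    module

lemma courant_add_smul_right (c : ℝ) {s t t' : ASection I M}
    (ht : SmoothSection t) (ht' : SmoothSection t') (x : M) :
    courant s (fun y ↦ c • t y + t' y) x = c • courant s t x + courant s t' x := by
  ext1
  · simp only [courant, Prod.fst_add, Prod.smul_fst]
    rw [mlieBracket_fun_add_right (ht.1.const_smul c) ht'.1,
      mlieBracket_fun_const_smul_right c ht.1]
  · simp only [courant, Prod.snd_add, Prod.smul_snd, Prod.fst_add, Prod.smul_fst]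
    rw [lieDeriv_add_right (ht.2.const_smul c) ht'.2, lieDeriv_const_smul_right c ht.2]
    simp only [map_add, map_smul]
    module

section shift

variable {c : ℝ} {N P : AEndField I M} (hN : ∀ x a, N x a = c • a + P x a) (hP : SmoothAEnd P)
include hN hP

lemma contracted_shift {s t : ASection I M} (hs : SmoothSection s) (ht : SmoothSection t)
    (x : M) : contracted N s t x = c • courant s t x + contracted P s t x := by
  simp only [contracted, hN]
  rw [courant_add_smul_left c hs (hP s hs) ht, courant_add_smul_right c ht (hP t ht)]
  module

/-- Both terms of the torsion acquire the same `c² (s ∘ t) + c (P s ∘ t + s ∘ P t)`: in the second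
one, the two copies of `c P(s ∘ t)` cancel. -/
lemma torsion_shift {s t : ASection I M} (hs : SmoothSection s) (ht : SmoothSection t)
    (x : M) : torsion N s t x = torsion P s t x := by
  have hPt := hP t ht
  have hPs := hP s hs
  simp only [torsion, contracted_shift hN hP hs ht, hN]
  rw [courant_add_smul_left c hs hPs ((ht.const_smul c).add hPt),
    courant_add_smul_right c ht hPt, courant_add_smul_right c ht hPt]
  simp only [contracted]
  rw [(P x).map_add, (P x).map_smul]
  module

lemma isOuterNijenhuis_shift {L : Π x : M, Submodule ℝ (Fibre I x)}
    (hL : ∀ s t : ASection I M, (∀ x, s x ∈ L x) → (∀ x, t x ∈ L x) → ∀ x, courant s t x ∈ L x) :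
    IsOuterNijenhuis N L ↔ IsOuterNijenhuis P L := by
  refine forall₂_congr fun s t ↦ forall₄_congr fun hs ht hsL htL ↦ ?_
  simp only [contracted_shift hN hP hs ht, torsion_shift hN hP hs ht]
  refine and_congr_left fun _ ↦ forall_congr' fun x ↦ ?_
  -- The extra term `c • courant s t` lies in `L` because `L` is closed under the Courant bracket.
  exact (L x).add_mem_iff_right ((L x).smul_mem c (hL s t hsL htL x))

end shift

/-! ### Presymplectic-Nijenhuis structures -/

/-- The one-form `L_X (ΩY) - i_Y d(ΩX) - Ω[X, Y]`. -/
noncomputable def closedDefect (Ω : CovTensor I M) (X Y : VField I M) : OneForm I M := fun x ↦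
  lieDeriv X (fun y ↦ Ω y (Y y)) x - dOne (fun y ↦ Ω y (X y)) x (Y x)
    - Ω x (mlieBracket I X Y x)

/-- The one-form `L_{N₀X} (ΩY) - i_{N₀Y} d(ΩX) - Ω[X, Y]_{N₀}`. -/
noncomputable def torsionForm (N₀ : EndField I M) (Ω : CovTensor I M) (X Y : VField I M) :
    OneForm I M := fun x ↦
  lieDeriv (fun y ↦ N₀ y (X y)) (fun y ↦ Ω y (Y y)) x
    - dOne (fun y ↦ Ω y (X y)) x (N₀ x (Y x)) - Ω x (bracketN N₀ X Y x)

omit [T2Space M] in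
lemma bracketN_smul_left {N₀ : EndField I M} {X Y : VField I M} {f : M → ℝ}
    (hN : SmoothEnd N₀) (hX : SmoothVF X) (hf : SmoothFun I f) (x : M) :
    bracketN N₀ (fun y ↦ f y • X y) Y x
      = f x • bracketN N₀ X Y x - mvfderiv I f x (N₀ x (Y x)) • X x := by
  simp only [bracketN, map_smul]
  rw [mlieBracket_fun_smul_left hf (hN X hX), mlieBracket_fun_smul_left hf hX,
    mlieBracket_fun_smul_left hf hX]
  simp only [map_sub, map_smul]
  module

section

variable {Ω : CovTensor I M} {N₀ : EndField I M} {X Y Z : VField I M}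
  (hΩ : SmoothCov Ω) (hN : SmoothEnd N₀)
  (hX : SmoothVF X) (hY : SmoothVF Y) (hZ : SmoothVF Z)
include hΩ hX hY hZ

omit [T2Space M] in
-- Links the closure condition on `TM` to `dΩ = 0`. Skewness is used to move the brackets from the
-- second slot of `Ω` to the first.
lemma closedDefect_apply (hskew : ∀ (x : M) (v w : TangentSpace I x), Ω x v w = - Ω x w v)
    (x : M) : closedDefect Ω X Y x (Z x) = dTwo Ω X Y Z x := by
  simp only [closedDefect, dTwo, sub_apply]
  rw [(hΩ Y hY).lieDeriv_apply X hZ, (hΩ X hX).dOne_apply hY hZ,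
    hskew x (Y x), hskew x (X x)]
  ring

include hN

omit [T2Space M] in
lemma torsionForm_apply (x : M) : torsionForm N₀ Ω X Y x (Z x) =
    mvfderiv I (fun y ↦ Ω y (Y y) (Z y)) x (N₀ x (X x))
      - Ω x (Y x) (mlieBracket I (fun y ↦ N₀ y (X y)) Z x)
      - mvfderiv I (fun y ↦ Ω y (X y) (Z y)) x (N₀ x (Y x))
      + mvfderiv I (fun y ↦ Ω y (X y) (N₀ y (Y y))) x (Z x)
      + Ω x (X x) (mlieBracket I (fun y ↦ N₀ y (Y y)) Z x)
      - Ω x (bracketN N₀ X Y x) (Z x) := by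
  simp only [torsionForm, sub_apply]
  rw [(hΩ Y hY).lieDeriv_apply _ hZ, (hΩ X hX).dOne_apply (hN Y hY) hZ]
  ring

omit [T2Space M] in
-- Skewness of both `Ω` and `ΩN₀` lets `N₀` pass from one argument of `Ω` to the other, which
-- matches the terms. For closed `Ω` only `-d(ΩN₀)` remains.
lemma torsionForm_apply_eq_dTwo
    (hskew : ∀ (x : M) (v w : TangentSpace I x), Ω x v w = - Ω x w v)
    (hskew' : ∀ (x : M) (v w : TangentSpace I x), Ω x (N₀ x v) w = - Ω x (N₀ x w) v)
    (x : M) : torsionForm N₀ Ω X Y x (Z x) =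
      dTwo Ω (fun y ↦ N₀ y (X y)) Y Z x + dTwo Ω X (fun y ↦ N₀ y (Y y)) Z x
        - dTwo (fun x ↦ (Ω x).comp (N₀ x)) X Y Z x := by
  have hsw : ∀ (y : M) (v w : TangentSpace I y), Ω y v (N₀ y w) = Ω y (N₀ y v) w := fun y v w ↦ by
    rw [hskew, ← hskew']
  rw [torsionForm_apply hΩ hN hX hY hZ]
  simp only [dTwo, bracketN, ContinuousLinearMap.comp_apply, map_add, map_sub, add_apply,
    sub_apply, hsw]
  rw [hskew x (Y x), hskew x (X x) (mlieBracket I (fun y ↦ N₀ y (Y y)) Z x),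
    ← hsw x (mlieBracket I X Z x) (Y x), ← hsw x (mlieBracket I Y Z x) (X x)]
  simp only [hsw]
  ring

omit [T2Space M] in
-- The anomaly is, for skew `Ω`, minus the symmetrization of `ΩN₀`. This is how the vanishing of the
-- torsion forces `ΩN₀` to be skew.
lemma torsionForm_smul_left_apply {f : M → ℝ} (hf : SmoothFun I f) (x : M) :
    torsionForm N₀ Ω (fun y ↦ f y • X y) Y x (Z x) = f x * torsionForm N₀ Ω X Y x (Z x)
      + mvfderiv I f x (Z x) * (Ω x (Y x) (N₀ x (X x)) + Ω x (X x) (N₀ x (Y x))) := by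
  rw [torsionForm_apply hΩ hN hX hY hZ,
    torsionForm_apply hΩ hN (SmoothVF.smul hf hX) hY hZ,
    bracketN_smul_left hN hX hf]
  simp only [map_smul, smul_apply, smul_eq_mul, map_sub, sub_apply]
  rw [mlieBracket_fun_smul_left hf (hN X hX),
    mvfderiv_fun_mul (hf.mdiff x) (((hΩ X hX).apply hZ).mdiff x),
    mvfderiv_fun_mul (hf.mdiff x) (((hΩ X hX).apply (hN Y hY)).mdiff x)]
  simp only [map_smul, map_sub, smul_apply, add_apply, smul_eq_mul]
  ring

end

section

variable {P : AEndField I M} {N₀ : EndField I M} {Λ : ContraTensor I M} {Ω : CovTensor I M}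
  (hP : ∀ (x : M) (v : TangentSpace I x) (ξ : Cotangent I x),
    P x (v, ξ) = (N₀ x v + Λ x ξ, Ω x v - ξ.comp (N₀ x)))
include hP

lemma contracted_tangent (X Y : VField I M) (x : M) :
    contracted P (fun y ↦ (X y, 0)) (fun y ↦ (Y y, 0)) x
      = (bracketN N₀ X Y x, closedDefect Ω X Y x) := by
  simp only [contracted, courant, hP, lieDeriv_zero_right, dOne_zero, map_zero, add_zero,
    ContinuousLinearMap.zero_comp, sub_zero, zero_apply, zero_sub]
  ext1
  · simp [bracketN]
  · simp only [closedDefect, Prod.snd_add, Prod.snd_sub]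
    abel

/-- Once `closedDefect` vanishes, `Λ` drops out and the two components separate into a condition on
`N₀` and a condition on `(N₀, Ω)`. -/
lemma torsion_tangent (X Y : VField I M) (x : M) :
    torsion P (fun y ↦ (X y, 0)) (fun y ↦ (Y y, 0)) x
      = (mlieBracket I (fun y ↦ N₀ y (X y)) (fun y ↦ N₀ y (Y y)) x - N₀ x (bracketN N₀ X Y x)
          - Λ x (closedDefect Ω X Y x),
        torsionForm N₀ Ω X Y x + (closedDefect Ω X Y x).comp (N₀ x)) := by
  rw [torsion, contracted_tangent hP]
  simp only [courant, hP, map_zero, add_zero, ContinuousLinearMap.zero_comp, sub_zero]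
  ext1
  · simp only [Prod.fst_sub]
    abel
  · simp only [Prod.snd_sub, torsionForm]
    abel

omit [T2Space M] hP in
lemma isOuterNijenhuis_tangentSub_iff (N : AEndField I M) :
    IsOuterNijenhuis N (fun x ↦ tangentSub x) ↔
      ∀ X Y : VField I M, SmoothVF X → SmoothVF Y → ∀ x,
        (contracted N (fun y ↦ (X y, 0)) (fun y ↦ (Y y, 0)) x).2 = 0 ∧
          torsion N (fun y ↦ (X y, 0)) (fun y ↦ (Y y, 0)) x = 0 := by
  constructor
  · intro h X Y hX hY x
    obtain ⟨h1, h2⟩ := h (fun y ↦ (X y, 0)) (fun y ↦ (Y y, 0)) ⟨hX, .zero⟩ ⟨hY, .zero⟩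
      (fun y ↦ by simp [tangentSub]) (fun y ↦ by simp [tangentSub])
    exact ⟨by simpa [tangentSub, Submodule.mem_prod] using h1 x, h2 x⟩
  · intro h s t hs ht hsL htL
    have key : ∀ {r : ASection I M}, (∀ x, r x ∈ tangentSub x) → r = fun x ↦ ((r x).1, 0) := by
      intro r hr
      ext1 x
      have := hr x
      simp only [tangentSub, Submodule.mem_prod, Submodule.mem_bot] at this
      ext1 <;> simp [this]
    rw [key hsL, key htL]
    have h' := h _ _ hs.1 ht.1
    exact ⟨fun x ↦ by simpa [tangentSub, Submodule.mem_prod] using (h' x).1, fun x ↦ (h' x).2⟩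

/-- The conditions for a skew-symmetric tensor on `TM ⊕ T*M` to be outer Nijenhuis for `TM`. -/
lemma isOuterNijenhuis_tangentSub_iff_presymplectic (hN : SmoothEnd N₀) (hΩ : SmoothCov Ω)
    (hskew : ∀ (x : M) (v w : TangentSpace I x), Ω x v w = - Ω x w v) :
    IsOuterNijenhuis P (fun x ↦ tangentSub x) ↔ IsPresymplecticNijenhuis N₀ Ω := by
  rw [isOuterNijenhuis_tangentSub_iff]
  simp only [contracted_tangent hP, torsion_tangent hP]
  have hΩN : SmoothCov (fun x ↦ (Ω x).comp (N₀ x)) := fun X hX ↦ hΩ _ (hN X hX)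
  constructor
  · intro h
    have hc : ∀ X Y, SmoothVF X → SmoothVF Y → ∀ x, closedDefect Ω X Y x = 0 :=
      fun X Y hX hY x ↦ (h X Y hX hY x).1
    have ht : ∀ X Y, SmoothVF X → SmoothVF Y → ∀ x, torsionForm N₀ Ω X Y x = 0 := by
      intro X Y hX hY x
      have := congrArg Prod.snd (h X Y hX hY x).2
      simpa [hc X Y hX hY x] using this
    have hd : ∀ X Y Z : VField I M, SmoothVF X → SmoothVF Y → SmoothVF Z → ∀ x,
        dTwo Ω X Y Z x = 0 := by
      intro X Y Z hX hY hZ x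
      rw [← closedDefect_apply hΩ hX hY hZ hskew, hc X Y hX hY]
      rfl
    have hskew' : ∀ (x : M) (v w : TangentSpace I x), Ω x (N₀ x v) w = - Ω x (N₀ x w) v := by
      intro x v w
      by_cases hv : v = 0
      · simp [hv]
      obtain ⟨X, hX, rfl⟩ := exists_smoothVF_eq x v
      obtain ⟨Y, hY, rfl⟩ := exists_smoothVF_eq x w
      obtain ⟨f, hf, hf1⟩ := exists_mvfderiv_apply_eq_one hv
      -- Evaluated at `Z = X`, where `df(X) = 1` at `x`, so that only the symmetric part of `ΩN₀` is
      -- left.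
      have := torsionForm_smul_left_apply hΩ hN hX hY hX hf x
      rw [ht _ _ (SmoothVF.smul hf hX) hY, ht _ _ hX hY, hf1,
        hskew x (Y x), hskew x (X x) (N₀ x (Y x))] at this
      simp only [zero_apply] at this
      linarith
    refine ⟨⟨hN, fun X Y hX hY x ↦ ?_⟩, ⟨hΩ, hskew, hd⟩, hΩN, hskew', fun X Y Z hX hY hZ x ↦ ?_⟩
    · have := congrArg Prod.fst (h X Y hX hY x).2
      simpa [hc X Y hX hY x] using this
    · have := torsionForm_apply_eq_dTwo hΩ hN hX hY hZ hskew hskew' x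
      rw [ht X Y hX hY, hd _ _ _ (hN X hX) hY hZ, hd _ _ _ hX (hN Y hY) hZ] at this
      simpa using this
  · rintro ⟨⟨-, hT⟩, ⟨-, -, hd⟩, -, hskew', hd'⟩ X Y hX hY x
    have hc : closedDefect Ω X Y x = 0 := cotangent_ext fun Z hZ ↦ by
      rw [closedDefect_apply hΩ hX hY hZ hskew, hd X Y Z hX hY hZ]
      rfl
    have ht : torsionForm N₀ Ω X Y x = 0 := cotangent_ext fun Z hZ ↦ by
      rw [torsionForm_apply_eq_dTwo hΩ hN hX hY hZ hskew hskew', hd' X Y Z hX hY hZ,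
        hd _ _ _ (hN X hX) hY hZ, hd _ _ _ hX (hN Y hY) hZ]
      simp
    simp [hc, ht, hT X Y hX hY x]

end

/-! ### Poisson-Nijenhuis structures -/

section

variable {N₀ : EndField I M} {Λ : ContraTensor I M}
  (hskew : ∀ (x : M) (α β : Cotangent I x), β (Λ x α) = - α (Λ x β))

lemma formBracket_smul_right {ξ η : OneForm I M}
    (hη : SmoothForm η) {f : M → ℝ} (hf : SmoothFun I f) (x : M) :
    formBracket Λ ξ (fun y ↦ f y • η y) x
      = f x • formBracket Λ ξ η x + mvfderiv I f x (Λ x (ξ x)) • η x := by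
  simp only [formBracket, map_smul]
  rw [lieDeriv_smul_right hf hη]
  module

include hskew in
-- The Lie derivative contributes `η(Λξ) df` and the exterior derivative `ξ(Λη) df`; these cancel
-- because `Λ` is skew.
lemma formBracket_smul_left (hΛ : SmoothContra Λ) {ξ η : OneForm I M}
    (hξ : SmoothForm ξ) (hη : SmoothForm η) {f : M → ℝ} (hf : SmoothFun I f) (x : M) :
    formBracket Λ (fun y ↦ f y • ξ y) η x
      = f x • formBracket Λ ξ η x - mvfderiv I f x (Λ x (η x)) • ξ x := by
  simp only [formBracket, map_smul]
  rw [lieDeriv_smul_left hf (hΛ ξ hξ) hη, dOne_smul hf hξ, hskew x (ξ x) (η x)]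
  module

lemma formBracket_add_left (hΛ : SmoothContra Λ) {ξ ξ' η : OneForm I M}
    (hξ : SmoothForm ξ) (hξ' : SmoothForm ξ') (hη : SmoothForm η) (x : M) :
    formBracket Λ (fun y ↦ ξ y + ξ' y) η x = formBracket Λ ξ η x + formBracket Λ ξ' η x := by
  simp only [formBracket, map_add]
  rw [lieDeriv_add_left (hΛ ξ hξ) (hΛ ξ' hξ') hη, dOne_add hξ hξ']
  simp only [add_apply]
  abel

lemma formBracket_add_right {ξ η η' : OneForm I M}
    (hη : SmoothForm η) (hη' : SmoothForm η') (x : M) :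
    formBracket Λ ξ (fun y ↦ η y + η' y) x = formBracket Λ ξ η x + formBracket Λ ξ η' x := by
  simp only [formBracket, map_add]
  rw [lieDeriv_add_right hη hη']
  abel

lemma formBracket_mvfderiv (hΛ : SmoothContra Λ) {f g : M → ℝ} (hf : SmoothFun I f)
    (hg : SmoothFun I g) (x : M) :
    formBracket Λ (mvfderiv I f) (mvfderiv I g) x = mvfderiv I (poissonBracket Λ f g) x := by
  simp only [formBracket]
  rw [lieDeriv_mvfderiv (hΛ _ hf.smoothForm) hg, dOne_mvfderiv hf]
  simp only [zero_apply, sub_zero]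
  rfl

/-- The vector field `[Λξ, Λη] - Λ[ξ, η]^Λ`. -/
noncomputable def anchorDefect (Λ : ContraTensor I M) (ξ η : OneForm I M) : VField I M := fun x ↦
  mlieBracket I (fun y ↦ Λ y (ξ y)) (fun y ↦ Λ y (η y)) x - Λ x (formBracket Λ ξ η x)

include hskew in
-- Since `Λ df` acts on functions as `{f, ·}`, the commutator gives `{f, {g, h}} - {g, {f, h}}`, and
-- the remaining term `-{{f, g}, h}` comes from `[df, dg]^Λ = d{f, g}`.
lemma mvfderiv_anchorDefect (hΛ : SmoothContra Λ) {f g h : M → ℝ} (hf : SmoothFun I f)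
    (hg : SmoothFun I g) (hh : SmoothFun I h) (x : M) :
    mvfderiv I h x (anchorDefect Λ (mvfderiv I f) (mvfderiv I g) x)
      = poissonBracket Λ f (poissonBracket Λ g h) x + poissonBracket Λ g (poissonBracket Λ h f) x
          + poissonBracket Λ h (poissonBracket Λ f g) x := by
  have hXf := hΛ _ hf.smoothForm
  have hXg := hΛ _ hg.smoothForm
  have h1 : poissonBracket Λ h f = - poissonBracket Λ f h := by
    ext y
    exact hskew y _ _
  simp only [anchorDefect, map_sub]
  rw [mvfderiv_mlieBracket hXf hXg hh, formBracket_mvfderiv hΛ hf hg, hskew, h1]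
  have h2 : poissonBracket Λ g (-poissonBracket Λ f h) x
      = - poissonBracket Λ g (poissonBracket Λ f h) x := by
    simp [poissonBracket, mvfderiv_neg]
  have h3 : ∀ f h : M → ℝ, dirDeriv (fun y ↦ Λ y (mvfderiv I f y)) h = poissonBracket Λ f h :=
    fun _ _ ↦ rfl
  rw [h2, h3, h3, h3, h3]
  simp only [poissonBracket]
  ring

include hskew in
/-- The Jacobi identity for `Λ` says that `Λ` intertwines `[·, ·]^Λ` with the Lie bracket. -/
lemma jacobi_iff_anchorDefect (hΛ : SmoothContra Λ) :
    (∀ f g h : M → ℝ, SmoothFun I f → SmoothFun I g → SmoothFun I h → ∀ x,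
        poissonBracket Λ f (poissonBracket Λ g h) x + poissonBracket Λ g (poissonBracket Λ h f) x
          + poissonBracket Λ h (poissonBracket Λ f g) x = 0) ↔
      ∀ ξ η : OneForm I M, SmoothForm ξ → SmoothForm η → ∀ x, anchorDefect Λ ξ η x = 0 := by
  constructor
  · intro h ξ η hξ hη x
    -- The derivative terms of the two brackets cancel, so `anchorDefect` is `C^∞(M)`-bilinear and
    -- can be tested on exact forms, one argument at a time.
    refine eq_zero_of_exact (x := x) (Φ := fun ξ ↦ anchorDefect Λ ξ η x) ?_ ?_ ?_ hξ
    · intro ξ ξ' hξ hξ'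
      simp only [anchorDefect, map_add]
      rw [formBracket_add_left hΛ hξ hξ' hη, mlieBracket_fun_add_left (hΛ ξ hξ) (hΛ ξ' hξ'),
        map_add]
      abel
    · intro f ξ hf hξ
      simp only [anchorDefect, map_smul]
      rw [formBracket_smul_left hskew hΛ hξ hη hf, mlieBracket_fun_smul_left hf (hΛ ξ hξ),
        map_sub, map_smul, map_smul]
      module
    intro f hf
    refine eq_zero_of_exact (x := x) (Φ := fun η ↦ anchorDefect Λ (mvfderiv I f) η x) ?_ ?_ ?_ hη
    · intro η η' hη hη'
      simp only [anchorDefect, map_add]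
      rw [formBracket_add_right hη hη', mlieBracket_fun_add_right (hΛ η hη) (hΛ η' hη'),
        map_add]
      abel
    · intro g η hg hη
      simp only [anchorDefect, map_smul]
      rw [formBracket_smul_right hη hg, mlieBracket_fun_smul_right hg (hΛ η hη),
        map_add, map_smul, map_smul]
      module
    intro g hg
    refine tangent_eq_zero fun k hk ↦ ?_
    rw [mvfderiv_anchorDefect hskew hΛ hf hg hk]
    exact h f g k hf hg hk x
  · intro h f g k hf hg hk x
    rw [← mvfderiv_anchorDefect hskew hΛ hf hg hk, h _ _ hf.smoothForm hg.smoothForm, map_zero]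

/-- The one-form `L_{Λξ} (ᵗN₀η) - i_{Λη} d(ᵗN₀ξ) - ᵗN₀[ξ, η]^Λ`. -/
noncomputable def dualDefect (N₀ : EndField I M) (Λ : ContraTensor I M) (ξ η : OneForm I M) :
    OneForm I M := fun x ↦
  lieDeriv (fun y ↦ Λ y (ξ y)) (dualApply N₀ η) x - dOne (dualApply N₀ ξ) x (Λ x (η x))
    - (formBracket Λ ξ η x).comp (N₀ x)

include hskew in
-- The anomaly is the symmetric part of `N₀Λ`; its vanishing will yield `N₀Λ = Λ ᵗN₀`.
lemma dualDefect_smul_left (hN : SmoothEnd N₀) (hΛ : SmoothContra Λ) {ξ η : OneForm I M}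
    (hξ : SmoothForm ξ) (hη : SmoothForm η) {f : M → ℝ} (hf : SmoothFun I f) (x : M) :
    dualDefect N₀ Λ (fun y ↦ f y • ξ y) η x = f x • dualDefect N₀ Λ ξ η x
      + (η x (N₀ x (Λ x (ξ x))) + ξ x (N₀ x (Λ x (η x)))) • mvfderiv I f x := by
  have h1 : dualApply N₀ (fun y ↦ f y • ξ y) = fun y ↦ f y • dualApply N₀ ξ y := by
    ext; simp [dualApply]
  simp only [dualDefect, h1, map_smul]
  rw [lieDeriv_smul_left hf (hΛ ξ hξ) (hN.dualApply hη), dOne_smul hf (hN.dualApply hξ),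
    formBracket_smul_left hskew hΛ hξ hη hf]
  simp only [dualApply, ContinuousLinearMap.sub_comp, ContinuousLinearMap.smul_comp,
    ContinuousLinearMap.comp_apply]
  module

end

section

variable {P : AEndField I M} {N₀ : EndField I M} {Λ : ContraTensor I M} {Ω : CovTensor I M}
  (hP : ∀ (x : M) (v : TangentSpace I x) (ξ : Cotangent I x),
    P x (v, ξ) = (N₀ x v + Λ x ξ, Ω x v - ξ.comp (N₀ x)))

lemma courant_cotangent {ξ η : OneForm I M} (hη : SmoothForm η) (x : M) :
    courant (fun y ↦ (0, ξ y)) (fun y ↦ (0, η y)) x = 0 := by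
  simp only [courant, mlieBracket_fun_zero_left, lieDeriv_zero_left hη, map_zero, sub_zero]
  rfl

include hP

/-- The `TM`-component is zero, so closure of `T*M` under the contracted product imposes no
condition. -/
lemma contracted_cotangent (hN : SmoothEnd N₀) {ξ η : OneForm I M}
    (hη : SmoothForm η) (x : M) :
    contracted P (fun y ↦ (0, ξ y)) (fun y ↦ (0, η y)) x = (0, formBracket Λ ξ η x) := by
  have hd : lieDeriv (fun _ ↦ 0) (fun y ↦ -(η y).comp (N₀ y)) x = 0 :=
    lieDeriv_zero_left (hN.dualApply hη).neg x
  rw [contracted, courant_cotangent hη, (P x).map_zero]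
  simp only [courant, hP, map_zero, zero_add, zero_sub, mlieBracket_fun_zero_left,
    mlieBracket_fun_zero_right, hd]
  ext1
  · simp
  · simp [formBracket, sub_eq_add_neg]

/-- `Ω` does not appear: `P` is only ever applied to sections of `T*M`. -/
lemma torsion_cotangent (hN : SmoothEnd N₀) {ξ η : OneForm I M}
    (hξ : SmoothForm ξ) (hη : SmoothForm η) (x : M) :
    torsion P (fun y ↦ (0, ξ y)) (fun y ↦ (0, η y)) x
      = (anchorDefect Λ ξ η x, - dualDefect N₀ Λ ξ η x) := by
  have h1 : ∀ X : VField I M, lieDeriv X (fun y ↦ -(η y).comp (N₀ y)) x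
      = - lieDeriv X (dualApply N₀ η) x := fun X ↦ lieDeriv_neg_right (hN.dualApply hη) x
  have h2 : dOne (fun y ↦ -(ξ y).comp (N₀ y)) x = - dOne (dualApply N₀ ξ) x :=
    dOne_neg (hN.dualApply hξ) x
  rw [torsion, contracted_cotangent hP hN hη]
  simp only [courant, hP, map_zero, zero_add, zero_sub, h1, h2]
  ext1
  · simp [anchorDefect]
  · simp only [dualDefect, Prod.snd_sub, neg_apply]
    abel

omit [T2Space M] hP in
lemma isOuterNijenhuis_cotangentSub_iff (N : AEndField I M) :
    IsOuterNijenhuis N (fun x ↦ cotangentSub x) ↔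
      ∀ ξ η : OneForm I M, SmoothForm ξ → SmoothForm η → ∀ x,
        (contracted N (fun y ↦ (0, ξ y)) (fun y ↦ (0, η y)) x).1 = 0 ∧
          torsion N (fun y ↦ (0, ξ y)) (fun y ↦ (0, η y)) x = 0 := by
  constructor
  · intro h ξ η hξ hη x
    obtain ⟨h1, h2⟩ := h (fun y ↦ (0, ξ y)) (fun y ↦ (0, η y)) ⟨.zero, hξ⟩ ⟨.zero, hη⟩
      (fun y ↦ by simp [cotangentSub]) (fun y ↦ by simp [cotangentSub])
    exact ⟨by simpa [cotangentSub, Submodule.mem_prod] using h1 x, h2 x⟩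
  · intro h s t hs ht hsL htL
    have key : ∀ {r : ASection I M}, (∀ x, r x ∈ cotangentSub x) →
        r = fun x ↦ (0, (r x).2) := by
      intro r hr
      ext1 x
      have := hr x
      simp only [cotangentSub, Submodule.mem_prod, Submodule.mem_bot] at this
      ext1 <;> simp [this]
    rw [key hsL, key htL]
    have h' := h _ _ hs.2 ht.2
    exact ⟨fun x ↦ by simpa [cotangentSub, Submodule.mem_prod] using (h' x).1, fun x ↦ (h' x).2⟩

/-- The conditions for a skew-symmetric tensor on `TM ⊕ T*M` to be outer Nijenhuis for `T*M`. -/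
lemma isOuterNijenhuis_cotangentSub_iff_poisson (hT : IsNijenhuis N₀) (hΛ : SmoothContra Λ)
    (hskew : ∀ (x : M) (α β : Cotangent I x), β (Λ x α) = - α (Λ x β)) :
    IsOuterNijenhuis P (fun x ↦ cotangentSub x) ↔ IsPoissonNijenhuis N₀ Λ := by
  have hN := hT.1
  -- Under `N₀Λ = Λ ᵗN₀`, the terms `L_{Λ ᵗN₀ξ} η` and `i_{Λ ᵗN₀η} dξ` cancel against `[ξ,
  -- η]^{N₀Λ}`.
  have key : (∀ (x : M) (α : Cotangent I x), N₀ x (Λ x α) = Λ x (α.comp (N₀ x))) →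
      ∀ (ξ η : OneForm I M) (x : M),
      formBracket Λ (dualApply N₀ ξ) η x + formBracket Λ ξ (dualApply N₀ η) x
          - dualApply N₀ (formBracket Λ ξ η) x
          - formBracket (fun x ↦ (N₀ x).comp (Λ x)) ξ η x = dualDefect N₀ Λ ξ η x := by
    intro hcomm ξ η x
    simp only [formBracket, dualDefect, ContinuousLinearMap.comp_apply, hcomm, dualApply]
    abel
  have h1 : IsOuterNijenhuis P (fun x ↦ cotangentSub x) ↔
      (∀ ξ η : OneForm I M, SmoothForm ξ → SmoothForm η → ∀ x, anchorDefect Λ ξ η x = 0) ∧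
      ∀ ξ η : OneForm I M, SmoothForm ξ → SmoothForm η → ∀ x, dualDefect N₀ Λ ξ η x = 0 := by
    rw [isOuterNijenhuis_cotangentSub_iff]
    constructor
    · intro h
      have h' : ∀ ξ η : OneForm I M, SmoothForm ξ → SmoothForm η → ∀ x,
          (anchorDefect Λ ξ η x, - dualDefect N₀ Λ ξ η x) = 0 := fun ξ η hξ hη x ↦ by
        rw [← torsion_cotangent hP hN hξ hη]
        exact (h ξ η hξ hη x).2
      exact ⟨fun ξ η hξ hη x ↦ congrArg Prod.fst (h' ξ η hξ hη x),
        fun ξ η hξ hη x ↦ neg_eq_zero.1 (congrArg Prod.snd (h' ξ η hξ hη x))⟩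
    · rintro ⟨h, h'⟩ ξ η hξ hη x
      rw [contracted_cotangent hP hN hη, torsion_cotangent hP hN hξ hη, h ξ η hξ hη,
        h' ξ η hξ hη]
      simp
  rw [h1, ← jacobi_iff_anchorDefect hskew hΛ]
  constructor
  · rintro ⟨hJ, hD⟩
    have hcomm : ∀ (x : M) (α : Cotangent I x), N₀ x (Λ x α) = Λ x (α.comp (N₀ x)) := by
      intro x α
      rw [← sub_eq_zero]
      refine tangent_eq_zero fun g hg ↦ ?_
      obtain ⟨ξ, hξ, rfl⟩ := exists_smoothForm_eq x α
      rw [map_sub, hskew x ((ξ x).comp (N₀ x)), ContinuousLinearMap.comp_apply, sub_neg_eq_add]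
      -- The goal is the anomaly coefficient of `dualDefect_smul_left` with `η = dg`. Cancelling
      -- `df` requires some `df ≠ 0` at `x`; if there is none, all tangent vectors at `x` vanish and
      -- the goal is trivial.
      by_cases hv : N₀ x (Λ x (ξ x)) = 0 ∧ N₀ x (Λ x (mvfderiv I g x)) = 0
      · simp [hv.1, hv.2]
      have hf : ∃ f : M → ℝ, SmoothFun I f ∧ mvfderiv I f x ≠ 0 := by
        by_contra! hcon
        exact hv ⟨tangent_eq_zero fun f hf ↦ by simp [hcon f hf],
          tangent_eq_zero fun f hf ↦ by simp [hcon f hf]⟩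
      obtain ⟨f, hf, hf0⟩ := hf
      have := dualDefect_smul_left hskew hN hΛ hξ hg.smoothForm hf x
      rw [hD _ _ (SmoothForm.smul hf hξ) hg.smoothForm, hD _ _ hξ hg.smoothForm, smul_zero,
        zero_add] at this
      exact (smul_eq_zero.1 this.symm).resolve_right hf0
    refine ⟨hT, ⟨hΛ, hskew, hJ⟩, hcomm, fun ξ η hξ hη x ↦ sub_eq_zero.1 ?_⟩
    rw [key hcomm, hD ξ η hξ hη]
  · rintro ⟨-, ⟨-, -, hJ⟩, hcomm, hB⟩
    refine ⟨hJ, fun ξ η hξ hη x ↦ ?_⟩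
    rw [← key hcomm, hB ξ η hξ hη, sub_self]

end

/-! ### The characterization -/

lemma courant_mem_tangentSub {s t : ASection I M} (hs : ∀ x, s x ∈ tangentSub x)
    (ht : ∀ x, t x ∈ tangentSub x) (x : M) : courant s t x ∈ tangentSub x := by
  simp only [tangentSub, Submodule.mem_prod, Submodule.mem_top, Submodule.mem_bot,
    true_and] at hs ht ⊢
  simp only [courant, hs, ht, lieDeriv_zero_right, dOne_zero, zero_apply, sub_zero]

omit [T2Space M] in
lemma courant_mem_cotangentSub {s t : ASection I M} (hs : ∀ x, s x ∈ cotangentSub x)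
    (ht : ∀ x, t x ∈ cotangentSub x) (x : M) : courant s t x ∈ cotangentSub x := by
  simp only [cotangentSub, Submodule.mem_prod, Submodule.mem_top, Submodule.mem_bot,
    and_true] at hs ht ⊢
  simp only [courant, hs, ht, mlieBracket_fun_zero_left]

/-- A smooth tensor in block form, shifted by a multiple of the identity, is outer Nijenhuis for
`TM` and `T*M` iff its blocks form presymplectic- and Poisson-Nijenhuis structures. -/
lemma isOuterNijenhuis_iff {N : AEndField I M} {k : ℝ} {N₀ : EndField I M}
    {Λ : ContraTensor I M} {Ω : CovTensor I M}
    (hNb : ∀ (x : M) (v : TangentSpace I x) (ξ : Cotangent I x),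
      N x (v, ξ) = (k • v + N₀ x v + Λ x ξ, Ω x v + (k • ξ - ξ.comp (N₀ x))))
    (hN₀ : SmoothEnd N₀) (hΛ : SmoothContra Λ) (hΩ : SmoothCov Ω)
    (hΩskew : ∀ (x : M) (v w : TangentSpace I x), Ω x v w = - Ω x w v)
    (hΛskew : ∀ (x : M) (α β : Cotangent I x), β (Λ x α) = - α (Λ x β)) :
    (IsOuterNijenhuis N (fun x ↦ tangentSub x) ∧ IsOuterNijenhuis N (fun x ↦ cotangentSub x)) ↔
      IsPresymplecticNijenhuis N₀ Ω ∧ IsPoissonNijenhuis N₀ Λ := by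
  let P : AEndField I M := fun x ↦ N x - k • ContinuousLinearMap.id ℝ (Fibre I x)
  have hNP : ∀ x a, N x a = k • a + P x a := fun x a ↦ by simp [P]
  have hP : ∀ (x : M) (v : TangentSpace I x) (ξ : Cotangent I x),
      P x (v, ξ) = (N₀ x v + Λ x ξ, Ω x v - ξ.comp (N₀ x)) := by
    intro x v ξ
    simp only [P, sub_apply, smul_apply, ContinuousLinearMap.id_apply, hNb]
    ext1
    · simp only [Prod.fst_sub, Prod.smul_fst]
      abel
    · simp only [Prod.snd_sub, Prod.smul_snd]
      abel
  have hPs : SmoothAEnd P := by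
    intro s hs
    have : (fun x ↦ P x (s x)) = fun x ↦ (N₀ x (s x).1 + Λ x (s x).2,
        Ω x (s x).1 - (s x).2.comp (N₀ x)) := funext fun x ↦ hP x (s x).1 (s x).2
    rw [this]
    exact ⟨(hN₀ _ hs.1).add (hΛ _ hs.2), (hΩ _ hs.1).sub (hN₀.dualApply hs.2)⟩
  rw [isOuterNijenhuis_shift hNP hPs fun s t hs ht ↦ courant_mem_tangentSub hs ht,
    isOuterNijenhuis_shift hNP hPs fun s t hs ht ↦ courant_mem_cotangentSub hs ht,
    isOuterNijenhuis_tangentSub_iff_presymplectic hP hN₀ hΩ hΩskew]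
  -- The Nijenhuis property of `N₀` comes from the `TM` half; the `T*M` half alone does not give it
  -- (for instance when `Λ = 0`).
  exact and_congr_right fun h ↦ isOuterNijenhuis_cotangentSub_iff_poisson hP h.1 hΛ hΛskew

end

end CourantNijenhuis

open CourantNijenhuis in
theorem theorem10
    {E : Type*} [NormedAddCommGroup E] [NormedSpace ℝ E] [FiniteDimensional ℝ E]
    {H : Type*} [TopologicalSpace H] (I : ModelWithCorners ℝ E H) [I.Boundaryless]
    {M : Type*} [TopologicalSpace M] [T2Space M] [ChartedSpace H M] [IsManifold I ∞ M]
    (N : CourantNijenhuis.AEndField I M) :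
    CourantNijenhuis.IsLieBialgebroidNijenhuis N ↔
      ∃ (c : ℝ) (N₀ : CourantNijenhuis.EndField I M) (Λ : CourantNijenhuis.ContraTensor I M)
        (Ω : CourantNijenhuis.CovTensor I M),
        (∀ (x : M) (v : TangentSpace I x) (ξ : CourantNijenhuis.Cotangent I x),
          N x (v, ξ) =
            ((c / 2) • v + N₀ x v + Λ x ξ, Ω x v + ((c / 2) • ξ - ξ.comp (N₀ x)))) ∧
        CourantNijenhuis.IsNijenhuis N₀ ∧
        CourantNijenhuis.IsPresymplecticNijenhuis N₀ Ω ∧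
        CourantNijenhuis.IsPoissonNijenhuis N₀ Λ := by
  constructor
  · rintro ⟨hs, ⟨c, N', hadj, hsum⟩, hT⟩
    -- Pairedness with the adjoint eliminated; testing it on pure vectors and covectors yields all
    -- the block relations.
    have hpair : ∀ (x : M) (a b : Fibre I x),
        pairing I x (N x a) b + pairing I x a (N x b) = c * pairing I x a b := by
      intro x a b
      have h : N' x b = c • b - N x b := eq_sub_of_add_eq' (hsum x b)
      rw [hadj, h]
      simp only [pairing, Prod.fst_sub, Prod.snd_sub, Prod.smul_fst, Prod.smul_snd, map_sub,
        map_smul, sub_apply, smul_apply, smul_eq_mul]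
      ring
    let N₀ : EndField I M := fun x ↦
      (ContinuousLinearMap.fst ℝ _ _).comp ((N x).comp (ContinuousLinearMap.inl ℝ _ _))
        - (c / 2) • ContinuousLinearMap.id ℝ _
    let Λ : ContraTensor I M := fun x ↦
      (ContinuousLinearMap.fst ℝ _ _).comp ((N x).comp (ContinuousLinearMap.inr ℝ _ _))
    let Ω : CovTensor I M := fun x ↦
      (ContinuousLinearMap.snd ℝ _ _).comp ((N x).comp (ContinuousLinearMap.inl ℝ _ _))
    have hN₀ : ∀ x v, N₀ x v = (N x (v, 0)).1 - (c / 2) • v := fun x v ↦ rfl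
    have hΛ : ∀ x ξ, Λ x ξ = (N x (0, ξ)).1 := fun x v ↦ rfl
    have hΩ : ∀ x v, Ω x v = (N x (v, 0)).2 := fun x v ↦ rfl
    have hblock : ∀ (x : M) (v : TangentSpace I x) (ξ : Cotangent I x),
          N x (v, ξ) =
            ((c / 2) • v + N₀ x v + Λ x ξ, Ω x v + ((c / 2) • ξ - ξ.comp (N₀ x))) := by
      intro x v ξ
      have h1 : N x (v, ξ) = N x (v, 0) + N x (0, ξ) := by
        rw [← (N x).map_add]
        simp
      have h2 : (N x (0, ξ)).2 = (c / 2) • ξ - ξ.comp (N₀ x) := by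
        -- Pairing a covector with a vector expresses the `T*M` block as `c` minus the transpose of
        -- the `TM` block `c/2 + N₀`.
        ext w
        have := hpair x (0, ξ) (w, 0)
        simp only [pairing, zero_apply, map_zero, add_zero] at this
        simp only [sub_apply, smul_apply, ContinuousLinearMap.comp_apply, hN₀, map_sub, map_smul,
          smul_eq_mul]
        linarith
      rw [h1, hN₀, hΛ, hΩ, ← h2]
      ext1
      · simp
      · simp
    -- `T*M` is isotropic, so `c` disappears and skewness remains; likewise for `Ω` on `TM`.
    have hΛskew : ∀ (x : M) (α β : Cotangent I x), β (Λ x α) = - α (Λ x β) := by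
      intro x α β
      have := hpair x (0, α) (0, β)
      simp only [pairing, map_zero, zero_add, add_zero, mul_zero] at this
      rw [hΛ, hΛ]
      linarith
    have hΩskew : ∀ (x : M) (v w : TangentSpace I x), Ω x v w = - Ω x w v := by
      intro x v w
      have := hpair x (v, 0) (w, 0)
      simp only [pairing, zero_apply, zero_add, add_zero, mul_zero] at this
      rw [hΩ, hΩ]
      linarith
    have hiff := isOuterNijenhuis_iff hblock
      (fun X hX ↦ (hs (fun x ↦ (X x, 0)) ⟨hX, .zero⟩).1.sub (hX.const_smul (c / 2)))
      (fun ξ hξ ↦ (hs (fun x ↦ (0, ξ x)) ⟨.zero, hξ⟩).1)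
      (fun X hX ↦ (hs (fun x ↦ (X x, 0)) ⟨hX, .zero⟩).2) hΩskew hΛskew
    obtain ⟨h1, h2⟩ := hiff.1 hT
    exact ⟨c, N₀, Λ, Ω, hblock, h1.1, h1, h2⟩
  · rintro ⟨c, N₀, Λ, Ω, hblock, hN₀, hΩ, hΛ⟩
    have hΩskew := hΩ.2.1.2.1
    have hΛskew := hΛ.2.1.2.1
    -- The adjoint has to be `c I - N`; that it is one follows from the block form and the skewness
    -- of `Ω` and `Λ`.
    refine ⟨fun s hs ↦ ?_, ⟨c, fun x ↦ c • ContinuousLinearMap.id ℝ _ - N x, ?_, ?_⟩,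
      (isOuterNijenhuis_iff hblock hN₀.1 hΛ.2.1.1 hΩ.2.1.1 hΩskew hΛskew).2 ⟨hΩ, hΛ⟩⟩
    · have : (fun x ↦ N x (s x)) = fun x ↦ ((c / 2) • (s x).1 + N₀ x (s x).1 + Λ x (s x).2,
          Ω x (s x).1 + ((c / 2) • (s x).2 - (s x).2.comp (N₀ x))) :=
        funext fun x ↦ hblock x (s x).1 (s x).2
      rw [this]
      exact ⟨((hs.1.const_smul _).add (hN₀.1 _ hs.1)).add (hΛ.2.1.1 _ hs.2),
        (hΩ.2.1.1 _ hs.1).add ((hs.2.const_smul _).sub (hN₀.1.dualApply hs.2))⟩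
    · rintro x ⟨v, ξ⟩ ⟨w, η⟩
      simp only [sub_apply, smul_apply, ContinuousLinearMap.id_apply, hblock, pairing,
        Prod.fst_sub, Prod.snd_sub, Prod.smul_fst, Prod.smul_snd, map_sub, map_add, map_smul,
        add_apply, ContinuousLinearMap.comp_apply, smul_eq_mul]
      rw [hΩskew x v w, hΛskew x ξ η]
      ring
    · intro x a
      simp
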